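/- Let $p,q\ge 0$ with $p+q=1$ and $q\neq 0$, and put $\tau=p/q$. Consider the asymmetric simple exclusion process (ASEP) on $\mathbb Z$ with $N$ particles: each particle independently waits a rate-one exponential time and then attempts to jump one step to the right with probability $p$ or one step to the left with probability $q$; the jump takes place if the target site is unoccupied, and otherwise the particle stays put. Let $x_1(t)<\cdots<x_N(t)$ be the positions of the particles at time $t\ge 0$, and let $\mathbb P_Y$ be the probability for the initial configuration $Y=\{y_1<\cdots<y_N\}\subset\mathbb Z$. Set $$f(\xi,\xi')=p+q\,\xi\xi'-\xi,\qquad \varepsilon(\xi)=p\,\xi^{-1}+q\,\xi-1,$$ for $S\subset\{1,\dots,N\}$ set $\sigma(S)=\#\{(i,j): i\in S,\ 1\le j\le N,\ i\ge j\}$, and let $$\left[{n\atop k}\right]_\tau=\frac{(1-\tau^n)(1-\tau^{n-1})\cdots(1-\tau^{n-k+1})}{(1-\tau)(1-\tau^2)\cdots(1-\tau^k)}$$ be the $\tau$-binomial coefficient (a polynomial in $\tau$, which gives its value at $\tau=1$). Let $\mathcal C_R$ be the positively oriented circle with center $0$ and radius $R>1$, where $R$ is so large that $f(\xi,\xi')\ne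 0$ whenever $|\xi|\ge R$ and $|\xi'|\ge R$. Then for $1\le m\le N$, every integer $x_m$ and every $t\ge 0$, $$\mathbb P_Y(x_m(t)=x_m)=(-1)^{m-1}\sum_{|S|\ge m}\tau^{\,m(m-1)/2+\sigma(S)-m|S|}\,q^{|S|(|S|-1)/2}\left[{|S|-1\atop m-1}\right]_\tau\, I(S),$$ where $S$ runs over the subsets of $\{1,\dots,N\}$ with at least $m$ elements and $$I(S)=\frac1{(2\pi i)^{|S|}}\int_{\mathcal C_R}\!\!\cdots\int_{\mathcal C_R}\ \prod_{i<j}\frac{\xi_j-\xi_i}{f(\xi_i,\xi_j)}\ \frac{1-\prod_i\xi_i}{\prod_i(1-\xi_i)}\ \prod_i\xi_i^{\,x_m-y_i-1}\ e^{\sum_i\varepsilon(\xi_i)\,t}\ \prod_i d\xi_i ,$$ all indices in the integrand running over $S$. (The exponent of $\tau$ is always nonnegative; if $p=0$, so that $\tau=0$, then $\tau^0=1$.) -/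

import Mathlib

open MeasureTheory Filter Topology
open scoped NNReal BoundedContinuousFunction

namespace ASEP

/-! ### The state space and the dynamics -/

/-- Configurations of `N` particles on `ℤ`: the position of the `i`-th particle from the left is
`η i`. As a subspace of `Fin N → ℤ` this space is discrete. -/
abbrev Config (N : ℕ) : Type := {η : Fin N → ℤ // StrictMono η}

/-- Particle `i` attempts a jump by one step (`d = 1` to the right, `d = -1` to the left); the jump
takes place if the target site is vacant, otherwise nothing changes. -/
def jump {N : ℕ} (η : Config N) (i : Fin N) (d : ℤˣ) : Config N :=
  if h : ∀ j, η.1 j ≠ η.1 i + (d : ℤ) then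
    ⟨Function.update η.1 i (η.1 i + (d : ℤ)), by
      intro a b hab
      have hlt : η.1 a < η.1 b := η.2 hab
      have ha := h a
      have hb := h b
      rcases Int.units_eq_one_or d with rfl | rfl <;>
        simp only [Function.update_apply, Units.val_one, Units.val_neg] at * <;>
        split_ifs with hai hbi hbi <;> subst_vars <;> omega⟩
  else η

/-- The rate-weighted sum that defines the generator:
`(L f)(η) = ∑ᵢ (p (f(ηⁱ⁺) - f(η)) + q (f(ηⁱ⁻) - f(η)))`, where `ηⁱ⁺`, `ηⁱ⁻` are the outcomes of an
attempted jump of particle `i` to the right and to the left. -/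
def generatorFun {N : ℕ} (p q : ℝ) (f : Config N → ℝ) (η : Config N) : ℝ :=
  ∑ i, (p * (f (jump η i 1) - f η) + q * (f (jump η i (-1)) - f η))

theorem abs_generatorFun_le {N : ℕ} (p q : ℝ) (f : Config N →ᵇ ℝ) (η : Config N) :
    |generatorFun p q f η| ≤ (N * (2 * |p| + 2 * |q|)) * ‖f‖ := by
  have key : ∀ a b : Config N, |f a - f b| ≤ 2 * ‖f‖ := fun a b => by
    simpa [Real.dist_eq] using f.dist_le_two_norm a b
  calc |generatorFun p q f η|
      ≤ ∑ i : Fin N, |p * (f (jump η i 1) - f η) + q * (f (jump η i (-1)) - f η)| :=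
        Finset.abs_sum_le_sum_abs _ _
    _ ≤ ∑ _i : Fin N, (|p| * (2 * ‖f‖) + |q| * (2 * ‖f‖)) := by
        refine Finset.sum_le_sum fun i _ => (abs_add_le _ _).trans ?_
        rw [abs_mul, abs_mul]
        gcongr
        · exact key _ _
        · exact key _ _
    _ = (N * (2 * |p| + 2 * |q|)) * ‖f‖ := by
        simp only [Finset.sum_const, Finset.card_univ, Fintype.card_fin, nsmul_eq_mul]
        ring

/-- The generator of the `N`-particle asymmetric simple exclusion process, as a bounded operator on
the bounded functions on the space of configurations. -/
noncomputable def generator (N : ℕ) (p q : ℝ) : (Config N →ᵇ ℝ) →L[ℝ] (Config N →ᵇ ℝ) :=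
  LinearMap.mkContinuous
    { toFun := fun f =>
        BoundedContinuousFunction.ofNormedAddCommGroupDiscrete (generatorFun p q f)
          ((N * (2 * |p| + 2 * |q|)) * ‖f‖) (abs_generatorFun_le p q f)
      map_add' := fun f g => by
        ext η
        simp only [BoundedContinuousFunction.coe_ofNormedAddCommGroupDiscrete,
          BoundedContinuousFunction.coe_add, Pi.add_apply, generatorFun, ← Finset.sum_add_distrib]
        exact Finset.sum_congr rfl fun i _ => by ring
      map_smul' := fun c f => by
        ext η
        simp only [BoundedContinuousFunction.coe_ofNormedAddCommGroupDiscrete,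
          BoundedContinuousFunction.coe_smul, smul_eq_mul, generatorFun, Finset.mul_sum,
          RingHom.id_apply]
        exact Finset.sum_congr rfl fun i _ => by ring }
    (N * (2 * |p| + 2 * |q|))
    fun f => BoundedContinuousFunction.norm_ofNormedAddCommGroup_le _ (by positivity)
      (abs_generatorFun_le p q f)

/-- The exponential of a bounded operator on a real normed space. -/
noncomputable def expOp {E : Type*} [NormedAddCommGroup E] [NormedSpace ℝ E] (A : E →L[ℝ] E) :
    E →L[ℝ] E :=
  NormedSpace.exp A

/-- The transition semigroup `exp (t L)` of the process. -/
noncomputable def semigroup (N : ℕ) (p q : ℝ) (t : ℝ≥0) : (Config N →ᵇ ℝ) →L[ℝ] (Config N →ᵇ ℝ) :=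
  expOp ((t : ℝ) • generator N p q)

/-- `X` is (on the probability space `(Ω, μ)`) an asymmetric simple exclusion process of `N`
particles with jump rates `p` to the right and `q` to the left, started from `Y`: a Markov process
with transition semigroup `exp (t L)` whose paths are right-continuous with left limits. -/
structure IsASEP {N : ℕ} (p q : ℝ) (Y : Config N) {Ω : Type*} [MeasurableSpace Ω] (μ : Measure Ω)
    (X : ℝ≥0 → Ω → Config N) : Prop where
  measurable : ∀ t, Measurable (X t)
  start : ∀ᵐ ω ∂μ, X 0 ω = Y
  markov : ∀ (s t : ℝ≥0) (f : Config N →ᵇ ℝ),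
    μ[fun ω => f (X (s + t) ω) | ⨆ u : Set.Iic s, MeasurableSpace.comap (X u) inferInstance]
      =ᵐ[μ] fun ω => semigroup N p q t f (X s ω)
  cadlag : ∀ᵐ ω ∂μ, ∀ t : ℝ≥0,
    ContinuousWithinAt (fun s => X s ω) (Set.Ici t) t ∧
      ∃ η, Tendsto (fun s => X s ω) (𝓝[<] t) (𝓝 η)

/-! ### The ingredients of the formula -/

/-- The `τ`-binomial coefficient, by the Pascal-type recursion, so that it makes sense at every
`τ`, including roots of unity. -/
def tauBinom (τ : ℝ) : ℕ → ℕ → ℝ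
  | _, 0 => 1
  | 0, _ + 1 => 0
  | n + 1, k + 1 => tauBinom τ n k + τ ^ (k + 1) * tauBinom τ n (k + 1)

theorem tauBinom_of_lt (τ : ℝ) : ∀ n k : ℕ, n < k → tauBinom τ n k = 0
  | 0, k + 1, _ => by simp [tauBinom]
  | n + 1, k + 1, h => by
      simp [tauBinom, tauBinom_of_lt τ n k (by omega), tauBinom_of_lt τ n (k + 1) (by omega)]

/-- Agreement with the product formula
`((1-τⁿ)(1-τⁿ⁻¹)⋯(1-τⁿ⁻ᵏ⁺¹)) / ((1-τ)(1-τ²)⋯(1-τᵏ))`. -/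
theorem tauBinom_mul_prod (τ : ℝ) : ∀ n k : ℕ, k ≤ n →
    tauBinom τ n k * ∏ i ∈ Finset.range k, (1 - τ ^ (i + 1))
      = ∏ i ∈ Finset.range k, (1 - τ ^ (n - i))
  | n, 0, _ => by simp [tauBinom]
  | n + 1, k + 1, h => by
      have h1 := tauBinom_mul_prod τ n k (by omega)
      rw [Finset.prod_range_succ' (fun i => 1 - τ ^ (n + 1 - i))]
      simp only [Nat.add_sub_add_right, Nat.sub_zero]
      rw [← h1]
      rcases Nat.lt_or_ge n (k + 1) with hk | hk
      · have hnk : n = k := by omega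
        subst hnk
        rw [tauBinom, tauBinom_of_lt τ n (n + 1) (by omega), Finset.prod_range_succ]
        ring
      · have h2 := tauBinom_mul_prod τ n (k + 1) hk
        rw [Finset.prod_range_succ (fun i => 1 - τ ^ (n - i)), ← h1] at h2
        have h3 : τ ^ (n + 1) = τ ^ (k + 1) * τ ^ (n - k) := by
          rw [← pow_add]; congr 1; omega
        rw [tauBinom, add_mul, mul_assoc (τ ^ (k + 1)), h2, Finset.prod_range_succ, h3]
        ring

/-- `σ(S) = #{(i, j) : i ∈ S, 1 ≤ j ≤ N, i ≥ j}`. -/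
def sig {N : ℕ} (S : Finset (Fin N)) : ℕ :=
  ((S ×ˢ (Finset.univ : Finset (Fin N))).filter fun z => z.2 ≤ z.1).card

/-- `f(ξ, ξ') = p + q ξ ξ' - ξ`. -/
def fpq (p q : ℝ) (ξ ξ' : ℂ) : ℂ := p + q * ξ * ξ' - ξ

/-- `ε(ξ) = p ξ⁻¹ + q ξ - 1`. -/
noncomputable def eps (p q : ℝ) (ξ : ℂ) : ℂ := p * ξ⁻¹ + q * ξ - 1

/-- The integrand, for variables `ξ₁, …, ξₖ` attached to the initial positions `y₁, …, yₖ`. -/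
noncomputable def integrand (p q : ℝ) {k : ℕ} (y : Fin k → ℤ) (x : ℤ) (t : ℝ) (ξ : Fin k → ℂ) : ℂ :=
  (∏ i, ∏ j ∈ Finset.Ioi i, (ξ j - ξ i) / fpq p q (ξ i) (ξ j)) *
    ((1 - ∏ i, ξ i) / ∏ i, (1 - ξ i)) *
    (∏ i, ξ i ^ (x - y i - 1)) * Complex.exp ((∑ i, eps p q (ξ i)) * t)

/-- The `k`-fold contour integral over the circle of radius `R` about `0`, every single integral
carrying a factor `1 / (2 π i)`. -/
noncomputable def contourIntegral {k : ℕ} (R : ℝ) (F : (Fin k → ℂ) → ℂ) : ℂ :=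
  (1 / (2 * (Real.pi : ℂ) * Complex.I)) ^ k * ∯ ξ in T((0 : Fin k → ℂ), fun _ => R), F ξ

/-- The radius `R` is so large that all zeros of the denominators `1 - ξ` and `f(ξ, ξ')` lie inside
the circle of radius `R` about `0`. -/
def IsLargeRadius (p q R : ℝ) : Prop :=
  1 < R ∧ ∀ ξ ξ' : ℂ, R ≤ ‖ξ‖ → R ≤ ‖ξ'‖ → fpq p q ξ ξ' ≠ 0

/-- All sufficiently large radii qualify. -/
theorem eventually_isLargeRadius {p q : ℝ} (hq : 0 < q) :
    ∀ᶠ R in atTop, IsLargeRadius p q R := by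
  filter_upwards [eventually_gt_atTop 1, eventually_gt_atTop ((|p| + 1) / q)] with R h1 h2
  refine ⟨h1, fun ξ ξ' hξ hξ' h => ?_⟩
  have h3 : |p| + 1 < R * q := by rwa [div_lt_iff₀ hq] at h2
  have h4 : (p : ℂ) = ξ * (1 - q * ξ') := by
    unfold fpq at h; linear_combination h
  have h5 : |p| = ‖ξ‖ * ‖1 - (q : ℂ) * ξ'‖ := by
    rw [← norm_mul, ← h4, Complex.norm_real, Real.norm_eq_abs]
  have h6 : ‖(q : ℂ) * ξ'‖ - ‖(1 : ℂ)‖ ≤ ‖1 - (q : ℂ) * ξ'‖ := by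
    rw [norm_sub_rev]; exact norm_sub_norm_le _ _
  rw [norm_mul, Complex.norm_real, Real.norm_of_nonneg hq.le, norm_one] at h6
  have h7 : R * q ≤ q * ‖ξ'‖ := by nlinarith
  have h8 : |p| < ‖1 - (q : ℂ) * ξ'‖ := by linarith
  nlinarith [norm_nonneg (1 - (q : ℂ) * ξ'), abs_nonneg p]

end ASEP

namespace ASEP

/-! ### Integrals over the torus -/

/-! The formula is verified as a function of the initial configuration, by a backward equation. The
generator `L` is bounded, so the probability is the series `∑ tⁿ/n! (Lⁿ 1)(Y)`, where `1` is the
indicator of `x_m = x` (`measureReal_eq_semigroup`, `hasSum_semigroup_apply`). Expanding the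
exponential under the contour integrals gives a power series in `t` as well (`hasSum_moment`). It
remains to match coefficients, by induction on `n` (`generator_pow_apply`).

Induction step: `y_a` enters the integrand only through a power of `ξ_a`, so multiplication by
`ε(ξ_a)` is the generator of a free walk in `y_a`, and the weighted sum over subsets obeys the
recursion of independent walks (`weightedMoment_succ`). Exclusion changes this only at neighbours
`y_j = y_i + 1`, and there the correction vanishes if `p U(y_i + 1) + q U(y_j - 1) = U`
(`sum_jump_eq`). Subsets containing both `i` and `j` satisfy this by antisymmetry of an integrand,
those containing neither because `p + q = 1`, and those containing exactly one cancel in pairs,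
because moving `i` to `j` multiplies the weight by `τ` (`weightedMoment_boundary`).

Case `n = 0`: the factor `1 - ∏ ξ` splits the integral into a difference of rational integrals with
exponents `c - y_i`, for `c = x - 1` and `c = x`. Such an integral is zero if an exponent is
negative (`kernelIntegral_eq_zero`). Otherwise the variables are integrated out one by one: the pole
at `1` gives a power of `1/q`, and the other residues integrate to zero (`kernelIntegral_cons`).
Hence only subsets of the initial segment `{i : y_i ≤ c}` contribute, and a `τ`-binomial identity
(`sum_subsets_initial_segment`) evaluates their sum to `(-1)^m` if `y_m ≤ c` and to `0` otherwise.
The difference over the two values of `c` is the indicator up to sign. -/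

theorem torusIntegrable_of_continuousOn {n : ℕ} {R : ℝ} (hR : 0 ≤ R) {f : (Fin n → ℂ) → ℂ}
    (hf : ContinuousOn f {ξ | ∀ i, ‖ξ i‖ = R}) :
    TorusIntegrable f 0 (fun _ => R) := by
  have h : Continuous fun θ : Fin n → ℝ => f (torusMap 0 (fun _ => R) θ) := by
    refine hf.comp_continuous ?_ ?_
    · unfold torusMap
      fun_prop
    · intro θ i
      simp [torusMap, Complex.norm_exp_ofReal_mul_I, abs_of_nonneg hR]
  exact h.continuousOn.integrableOn_compact isCompact_Icc

theorem norm_torusMap {n : ℕ} {R : ℝ} (hR : 0 ≤ R) (θ : Fin n → ℝ) (i : Fin n) :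
    ‖torusMap 0 (fun _ => R) θ i‖ = R := by
  simp [torusMap, Complex.norm_exp_ofReal_mul_I, abs_of_nonneg hR]

theorem torusIntegral_congr_ae {n : ℕ} {R : ℝ} {f g : (Fin n → ℂ) → ℂ}
    (h : ∀ᵐ θ : Fin n → ℝ, f (torusMap 0 (fun _ => R) θ) = g (torusMap 0 (fun _ => R) θ)) :
    (∯ ξ in T((0 : Fin n → ℂ), fun _ => R), f ξ) = ∯ ξ in T((0 : Fin n → ℂ), fun _ => R), g ξ := by
  unfold torusIntegral
  refine integral_congr_ae (ae_restrict_of_ae ?_)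
  filter_upwards [h] with θ hθ
  rw [hθ]

theorem torusIntegral_congr {n : ℕ} {R : ℝ} (hR : 0 ≤ R) {f g : (Fin n → ℂ) → ℂ}
    (h : ∀ ξ, (∀ i, ‖ξ i‖ = R) → f ξ = g ξ) :
    (∯ ξ in T((0 : Fin n → ℂ), fun _ => R), f ξ) = ∯ ξ in T((0 : Fin n → ℂ), fun _ => R), g ξ :=
  torusIntegral_congr_ae <| .of_forall fun θ => h _ (norm_torusMap hR θ)

/-- Fubini's theorem for the torus, with the distinguished variable integrated first. -/
theorem torusIntegral_insertNth {n : ℕ} {R : ℝ} {f : (Fin (n + 1) → ℂ) → ℂ}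
    (hf : TorusIntegrable f 0 (fun _ => R)) (i : Fin (n + 1)) :
    (∯ ξ in T((0 : Fin (n + 1) → ℂ), fun _ => R), f ξ) =
      ∯ ζ in T((0 : Fin n → ℂ), fun _ => R), ∮ z in C(0, R), f (i.insertNth z ζ) := by
  set e : ℝ × (Fin n → ℝ) ≃ᵐ (Fin (n + 1) → ℝ) :=
    (MeasurableEquiv.piFinSuccAbove (fun _ => ℝ) i).symm with he
  have hem : MeasurePreserving e :=
    (volume_preserving_piFinSuccAbove (fun _ : Fin (n + 1) => ℝ) i).symm _
  have heπ : (e ⁻¹' Set.Icc 0 fun _ => 2 * Real.pi) =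
      Set.Icc 0 (2 * Real.pi) ×ˢ Set.Icc (0 : Fin n → ℝ) fun _ => 2 * Real.pi :=
    ((Fin.insertNthOrderIso (fun _ => ℝ) i).preimage_Icc _ _).trans (Set.Icc_prod_eq _ _)
  have hint := hf.function_integrable
  rw [← hem.integrableOn_comp_preimage e.measurableEmbedding, heπ] at hint
  have hev : ∀ a b, e (a, b) = i.insertNth a b := fun a b => rfl
  have hmap : ∀ a b, torusMap (0 : Fin (n + 1) → ℂ) (fun _ => R) (i.insertNth a b) =
      i.insertNth (circleMap 0 R a) (torusMap (0 : Fin n → ℂ) (fun _ => R) b) := by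
    intro a b
    refine funext fun j => ?_
    refine Fin.succAboveCases i ?_ (fun j => ?_) j
    · simp [torusMap, circleMap]
    · simp [torusMap]
  rw [torusIntegral, ← hem.map_eq, setIntegral_map_equiv, heπ, Measure.volume_eq_prod,
    ← setIntegral_prod_swap]
  refine (setIntegral_prod _ hint.swap).trans ?_
  unfold torusIntegral
  refine setIntegral_congr_fun measurableSet_Icc fun Θ _ => ?_
  simp only [Function.comp_apply, Prod.swap, circleIntegral_def_Icc, ← integral_smul]
  refine setIntegral_congr_fun measurableSet_Icc fun θ _ => ?_
  simp only [hev, hmap, deriv_circleMap, smul_smul, i.prod_univ_succAbove,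
    Fin.insertNth_apply_same, Fin.insertNth_apply_succAbove, circleMap_zero]
  congr 1
  ring

/-- By Fubini the variable `j` may be integrated first. `Function.update` keeps the other variables
at their indices. -/
theorem torusIntegral_eq_zero_of_update {n : ℕ} {R : ℝ} (hR : 0 ≤ R) {f : (Fin n → ℂ) → ℂ}
    (hf : TorusIntegrable f 0 (fun _ => R)) (j : Fin n)
    (h : ∀ ξ : Fin n → ℂ, (∀ i, ‖ξ i‖ = R) → ∮ z in C(0, R), f (Function.update ξ j z) = 0) :
    (∯ ξ in T((0 : Fin n → ℂ), fun _ => R), f ξ) = 0 := by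
  obtain _ | n := n
  · exact j.elim0
  rw [torusIntegral_insertNth hf j,
    torusIntegral_congr (g := fun _ => 0) hR fun ζ hζ => ?_]
  · simp [torusIntegral]
  -- The entry `R` at `j` is overwritten by the update; it only has to lie on the circle.
  · have := h (j.insertNth (R : ℂ) ζ) fun i => by
      refine Fin.succAboveCases j ?_ (fun i => ?_) i
      · simp [abs_of_nonneg hR]
      · simpa using hζ i
    simpa only [Fin.update_insertNth] using this

theorem torusIntegral_comp_perm {n : ℕ} {R : ℝ} (f : (Fin n → ℂ) → ℂ) (s : Equiv.Perm (Fin n)) :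
    (∯ ξ in T((0 : Fin n → ℂ), fun _ => R), f (fun i => ξ (s i))) =
      ∯ ξ in T((0 : Fin n → ℂ), fun _ => R), f ξ := by
  have hem := volume_measurePreserving_piCongrLeft (fun _ : Fin n => ℝ) s.symm
  set e := MeasurableEquiv.piCongrLeft (fun _ : Fin n => ℝ) s.symm
  have hev : ∀ θ i, e θ i = θ (s i) := by
    intro θ i
    have := MeasurableEquiv.piCongrLeft_apply_apply s.symm (β := fun _ : Fin n => ℝ) θ (s i)
    simpa using this
  unfold torusIntegral
  conv_rhs => rw [← hem.map_eq, setIntegral_map_equiv]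
  have hpre : e ⁻¹' (Set.Icc 0 fun _ => 2 * Real.pi) = Set.Icc 0 fun _ => 2 * Real.pi := by
    ext θ
    simp only [Set.mem_preimage, Set.mem_Icc, Pi.le_def, hev, Pi.zero_apply]
    exact ⟨fun h => ⟨fun i => by simpa using h.1 (s.symm i), fun i => by
      simpa using h.2 (s.symm i)⟩, fun h => ⟨fun i => h.1 _, fun i => h.2 _⟩⟩
  rw [hpre]
  refine setIntegral_congr_fun measurableSet_Icc fun θ _ => ?_
  simp only [hev]
  congr 1
  · exact (Equiv.prod_comp s fun i => (R : ℂ) * Complex.exp (θ i * Complex.I) * Complex.I).symm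
  · congr 1
    ext i
    simp [torusMap, hev]

theorem torusIntegral_eq_zero_of_antisymm {n : ℕ} {R : ℝ} (hR : 0 ≤ R) {f : (Fin n → ℂ) → ℂ}
    (s : Equiv.Perm (Fin n))
    (h : ∀ ξ : Fin n → ℂ, (∀ i, ‖ξ i‖ = R) → f (fun i => ξ (s i)) = -f ξ) :
    (∯ ξ in T((0 : Fin n → ℂ), fun _ => R), f ξ) = 0 := by
  have h1 := torusIntegral_comp_perm (R := R) f s
  rw [torusIntegral_congr hR h, torusIntegral_neg] at h1
  exact self_eq_neg.mp h1.symm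

/-- Coincidences lie on the countably many hyperplanes `θ i - θ j ∈ 2πℤ`. Off them, the poles met in
the residue computation are simple. -/
theorem ae_torusMap_injective {n : ℕ} {R : ℝ} (hR : R ≠ 0) :
    ∀ᵐ θ : Fin n → ℝ, Function.Injective (torusMap (0 : Fin n → ℂ) (fun _ => R) θ) := by
  have key : ∀ i j : Fin n, i ≠ j → ∀ m : ℤ,
      ∀ᵐ θ : Fin n → ℝ, θ i - θ j ≠ m * (2 * Real.pi) := by
    intro i j hij m
    let L : (Fin n → ℝ) →ₗ[ℝ] ℝ := LinearMap.proj (R := ℝ) (φ := fun _ => ℝ) i - LinearMap.proj j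
    let A : AffineSubspace ℝ (Fin n → ℝ) :=
      AffineSubspace.comap L.toAffineMap (AffineSubspace.mk' (m * (2 * Real.pi)) ⊥)
    have hmem : ∀ θ, θ ∈ A ↔ θ i - θ j = m * (2 * Real.pi) := by
      intro θ
      simp [A, L, AffineSubspace.mem_comap, AffineSubspace.mem_mk', sub_eq_zero]
    have hA : A ≠ ⊤ := by
      intro h
      -- At this point `θ i - θ j` is too large by one.
      have h1 := (hmem (Pi.single i (m * (2 * Real.pi) + 1))).1 (by rw [h]; trivial)
      simp [hij.symm] at h1
    have := Measure.addHaar_affineSubspace volume A hA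
    rw [ae_iff]
    simp only [ne_eq, not_not, ← hmem]
    exact this
  have : ∀ᵐ θ : Fin n → ℝ, ∀ i j : Fin n, i ≠ j → ∀ m : ℤ, θ i - θ j ≠ m * (2 * Real.pi) := by
    rw [ae_all_iff]; intro i
    rw [ae_all_iff]; intro j
    by_cases hij : i = j
    · exact .of_forall fun θ h => absurd hij h
    · filter_upwards [ae_all_iff.2 (key i j hij)] with θ hθ _ using hθ
  filter_upwards [this] with θ hθ i j hij
  by_contra hne
  have h1 : Complex.exp (θ i * Complex.I) = Complex.exp (θ j * Complex.I) := by
    simpa [torusMap, hR] using hij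
  obtain ⟨m, hm⟩ := Complex.exp_eq_exp_iff_exists_int.1 h1
  refine hθ i j hne m ?_
  have h2 : ((θ i : ℂ) - θ j) * Complex.I = (m * (2 * Real.pi)) * Complex.I := by
    linear_combination hm
  have h3 := mul_right_cancel₀ Complex.I_ne_zero h2
  exact_mod_cast h3

/-! ### Integrals of rational functions over circles -/

/-- The circle can be enlarged without crossing a singularity, and the decay of `h` beats the
growing length. -/
theorem circleIntegral_eq_zero_of_tendsto {h : ℂ → ℂ} {R : ℝ} (hR : 0 < R)
    (hd : ∀ z, R ≤ ‖z‖ → DifferentiableAt ℂ h z)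
    (hlim : Tendsto (fun z => z * h z) (Bornology.cobounded ℂ) (𝓝 0)) :
    ∮ z in C(0, R), h z = 0 := by
  have hconst : ∀ r, R ≤ r → (∮ z in C(0, r), h z) = ∮ z in C(0, R), h z := by
    intro r hr
    refine Complex.circleIntegral_eq_of_differentiable_on_annulus_off_countable hR hr
      Set.countable_empty (fun z hz => ?_) (fun z hz => ?_)
    · exact (hd z (by simpa using hz.2)).continuousAt.continuousWithinAt
    · exact hd z (by simpa using (not_le.1 (by simpa using hz.1.2)).le)
  by_contra hne
  have hpos : 0 < ‖∮ z in C(0, R), h z‖ := norm_pos_iff.2 hne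
  set c := ‖∮ z in C(0, R), h z‖
  -- On a circle of radius `r`, of length `2πr`, this bound makes the integral at most `c / 2`.
  have hev : ∀ᶠ z in Bornology.cobounded ℂ, ‖z * h z‖ < c / (4 * Real.pi) := by
    have := hlim.norm
    rw [norm_zero] at this
    exact this.eventually_lt_const (by positivity)
  rw [← comap_norm_atTop, eventually_comap] at hev
  obtain ⟨r, hr, hr2⟩ := (hev.and (eventually_ge_atTop R)).exists
  have hr0 : 0 < r := hR.trans_le hr2
  have hb := circleIntegral.norm_integral_le_of_norm_le_const hr0.le (c := (0 : ℂ)) (f := h)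
    (C := c / (4 * Real.pi) / r) (by
      intro z hz
      have hz' : ‖z‖ = r := by simpa using hz
      have := hr z hz'
      rw [norm_mul, hz'] at this
      rw [le_div_iff₀ hr0]
      linarith)
  rw [hconst r hr2] at hb
  have : 2 * Real.pi * r * (c / (4 * Real.pi) / r) = c / 2 := by
    field_simp; norm_num
  rw [this] at hb
  change c ≤ c / 2 at hb
  linarith

/-- The residue theorem for a rational function with simple poles. -/
theorem circleIntegral_polynomial_div_prod {ι : Type*} [DecidableEq ι] (s : Finset ι) (v : ι → ℂ)
    (hv : Set.InjOn v s) (P : Polynomial ℂ) {R : ℝ} (hR : ∀ i ∈ s, ‖v i‖ < R) (hR0 : 0 < R) :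
    ∮ z in C(0, R), P.eval z / ∏ i ∈ s, (z - v i) =
      2 * Real.pi * Complex.I * ∑ i ∈ s, P.eval (v i) / ∏ j ∈ s.erase i, (v i - v j) := by
  -- Partial fractions: after removal of the Lagrange interpolant at the poles, the denominator
  -- divides `P`, and the quotient integrates to zero.
  have hdvd : Lagrange.nodal s v ∣ P - Lagrange.interpolate s v (fun i => P.eval (v i)) := by
    rw [Lagrange.nodal_eq]
    refine Finset.prod_dvd_of_coprime (fun i hi j hj hij => ?_) (fun i hi => ?_)
    · exact Polynomial.isCoprime_X_sub_C_of_isUnit_sub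
        (sub_ne_zero.2 fun h => hij (hv hi hj h)).isUnit
    · rw [Polynomial.dvd_iff_isRoot, Polynomial.IsRoot, Polynomial.eval_sub,
        Lagrange.eval_interpolate_at_node _ hv hi, sub_self]
  obtain ⟨Q, hQ⟩ := hdvd
  have hne : ∀ z ∈ Metric.sphere (0 : ℂ) R, ∀ i ∈ s, z - v i ≠ 0 := by
    intro z hz i hi h
    have h1 : ‖z‖ = R := by simpa using hz
    have h2 := hR i hi
    rw [← sub_eq_zero.1 h, h1] at h2
    exact lt_irrefl _ h2
  have hexp : ∀ z ∈ Metric.sphere (0 : ℂ) R, P.eval z / ∏ i ∈ s, (z - v i) =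
      Q.eval z + ∑ i ∈ s, (P.eval (v i) / ∏ j ∈ s.erase i, (v i - v j)) * (z - v i)⁻¹ := by
    intro z hz
    have hprod : ∏ i ∈ s, (z - v i) ≠ 0 := Finset.prod_ne_zero_iff.2 (hne z hz)
    have h1 : P = Lagrange.interpolate s v (fun i => P.eval (v i)) + Lagrange.nodal s v * Q := by
      rw [← hQ]; ring
    have h2 := congrArg (Polynomial.eval z) h1
    rw [Polynomial.eval_add, Polynomial.eval_mul, Lagrange.eval_interpolate_not_at_node _
      (fun i hi => sub_ne_zero.1 (hne z hz i hi)), Lagrange.eval_nodal] at h2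
    rw [h2, ← mul_add, mul_div_cancel_left₀ _ hprod, add_comm]
    congr 1
    refine Finset.sum_congr rfl fun i hi => ?_
    rw [Lagrange.nodalWeight, Finset.prod_inv_distrib]
    ring
  rw [circleIntegral.integral_congr hR0.le hexp]
  have hci : ∀ i ∈ s, CircleIntegrable
      (fun z => (P.eval (v i) / ∏ j ∈ s.erase i, (v i - v j)) * (z - v i)⁻¹) 0 R := by
    intro i hi
    refine ContinuousOn.circleIntegrable hR0.le (continuousOn_const.mul ?_)
    exact (continuousOn_id.sub continuousOn_const).inv₀ fun z hz => hne z hz i hi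
  rw [circleIntegral.integral_add (Q.continuous.continuousOn.circleIntegrable hR0.le)
    (CircleIntegrable.fun_sum s hci)]
  have hQ0 : ∮ z in C(0, R), Q.eval z = 0 :=
    Complex.circleIntegral_eq_zero_of_differentiable_on_off_countable hR0.le
      Set.countable_empty Q.continuous.continuousOn fun z _ => Q.differentiable z
  rw [hQ0, zero_add]
  rw [circleIntegral.integral_fun_sum hci, Finset.mul_sum]
  refine Finset.sum_congr rfl fun i hi => ?_
  rw [circleIntegral.integral_const_mul,
    circleIntegral.integral_sub_inv_of_mem_ball (by simpa using hR i hi)]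
  ring

theorem tendsto_moebius_cobounded (a b d : ℂ) {c : ℂ} (hc : c ≠ 0) :
    Tendsto (fun z => (a * z + b) / (c * z + d)) (Bornology.cobounded ℂ) (𝓝 (a / c)) := by
  have hinv : Tendsto (fun z : ℂ => z⁻¹) (Bornology.cobounded ℂ) (𝓝 0) := tendsto_inv₀_cobounded
  have h : Tendsto (fun z : ℂ => (a + b * z⁻¹) / (c + d * z⁻¹)) (Bornology.cobounded ℂ)
      (𝓝 ((a + b * 0) / (c + d * 0))) := by
    refine Tendsto.div ?_ ?_ (by simpa using hc)
    · exact tendsto_const_nhds.add (tendsto_const_nhds.mul hinv)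
    · exact tendsto_const_nhds.add (tendsto_const_nhds.mul hinv)
  simp only [mul_zero, add_zero] at h
  refine h.congr' ?_
  have hev : ∀ᶠ z : ℂ in Bornology.cobounded ℂ, z ≠ 0 := by
    filter_upwards [Bornology.eventually_ne_cobounded (0 : ℂ)] with z hz using hz
  filter_upwards [hev] with z hz
  rw [← mul_div_mul_right _ _ hz]
  congr 1 <;> field_simp

theorem tendsto_zpow_cobounded {n : ℤ} (hn : n < 0) :
    Tendsto (fun z : ℂ => z ^ n) (Bornology.cobounded ℂ) (𝓝 0) := by
  obtain ⟨k, rfl⟩ : ∃ k : ℕ, n = -((k : ℤ) + 1) := ⟨(-n - 1).toNat, by omega⟩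
  have := (tendsto_inv₀_cobounded (α := ℂ)).pow (k + 1)
  simp only [ne_eq, Nat.add_eq_zero_iff, one_ne_zero, and_false, not_false_eq_true, zero_pow] at this
  refine this.congr fun z => ?_
  rw [zpow_neg, inv_pow]
  norm_cast

/-! ### Products over pairs -/

theorem prod_pairs_split {k : ℕ} (G : Fin k → Fin k → ℂ) (j : Fin k) :
    ∏ i, ∏ l ∈ Finset.Ioi i, G i l =
      (∏ i ∈ Finset.univ.erase j, ∏ l ∈ (Finset.Ioi i).erase j, G i l) *
        ((∏ l ∈ Finset.Iio j, G l j) * ∏ l ∈ Finset.Ioi j, G j l) := by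
  rw [← Finset.mul_prod_erase _ _ (Finset.mem_univ j)]
  have h1 : ∀ i ∈ Finset.univ.erase j, ∏ l ∈ Finset.Ioi i, G i l =
      (∏ l ∈ (Finset.Ioi i).erase j, G i l) * if i < j then G i j else 1 := by
    intro i _
    split_ifs with h
    · rw [Finset.prod_erase_mul _ _ (by simpa using h)]
    · rw [Finset.erase_eq_of_notMem (by simpa using h), mul_one]
  rw [Finset.prod_congr rfl h1, Finset.prod_mul_distrib, ← Finset.prod_filter]
  have h2 : (Finset.univ.erase j).filter (fun i => i < j) = Finset.Iio j := by
    ext i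
    simp only [Finset.mem_filter, Finset.mem_erase, Finset.mem_univ, and_true, Finset.mem_Iio]
    exact ⟨fun h => h.2, fun h => ⟨h.ne, h⟩⟩
  rw [h2]
  ring

/-- An adjacent transposition reverses only the pair `(a, b)` and permutes the other ordered pairs;
`Q` is their product. -/
theorem prod_pairs_swap {k : ℕ} (G : Fin k → Fin k → ℂ) {a b : Fin k} (hab : (a : ℕ) + 1 = b) :
    ∃ Q, ∏ i, ∏ j ∈ Finset.Ioi i, G i j = G a b * Q ∧
      ∏ i, ∏ j ∈ Finset.Ioi i, G (Equiv.swap a b i) (Equiv.swap a b j) = G b a * Q := by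
  set s := Equiv.swap a b
  have hpair : ∀ H : Fin k → Fin k → ℂ, ∏ i, ∏ j ∈ Finset.Ioi i, H i j =
      H a b * ∏ z ∈ (Finset.univ.filter fun z : Fin k × Fin k => z.1 < z.2).erase (a, b),
        H z.1 z.2 := by
    intro H
    have hmem : (a, b) ∈ Finset.univ.filter fun z : Fin k × Fin k => z.1 < z.2 := by
      simp only [Finset.mem_filter, Finset.mem_univ, true_and, Fin.lt_def]; omega
    rw [Finset.mul_prod_erase _ (fun z : Fin k × Fin k => H z.1 z.2) hmem, Finset.prod_filter,
      Fintype.prod_prod_type]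
    refine Finset.prod_congr rfl fun i _ => ?_
    rw [← Finset.prod_filter]
    exact Finset.prod_congr (by ext; simp) fun _ _ => rfl
  refine ⟨_, hpair G, ?_⟩
  rw [hpair fun i j => G (s i) (s j)]
  have hsa : s a = b := Equiv.swap_apply_left a b
  have hsb : s b = a := Equiv.swap_apply_right a b
  rw [hsa, hsb]
  congr 1
  have hlt : ∀ i j : Fin k, i < j → (i, j) ≠ (a, b) → s i < s j ∧ (s i, s j) ≠ (a, b) := by
    intro i j hij hne
    have hne' : ¬ (i = a ∧ j = b) := by simpa using hne
    simp only [s, Equiv.swap_apply_def, ne_eq, Prod.mk.injEq]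
    simp only [Fin.ext_iff, Fin.lt_def] at *
    split_ifs <;> constructor <;> simp_all <;> omega
  refine Finset.prod_bij' (fun z _ => (s z.1, s z.2)) (fun z _ => (s z.1, s z.2)) ?_ ?_ ?_ ?_ ?_
  · rintro ⟨i, j⟩ hz
    simp only [Finset.mem_erase, Finset.mem_filter, Finset.mem_univ, true_and] at hz ⊢
    exact (hlt i j hz.2 hz.1).symm
  · rintro ⟨i, j⟩ hz
    simp only [Finset.mem_erase, Finset.mem_filter, Finset.mem_univ, true_and] at hz ⊢
    exact (hlt i j hz.2 hz.1).symm
  · rintro ⟨i, j⟩ _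
    simp [s]
  · rintro ⟨i, j⟩ _
    simp [s]
  · rintro ⟨i, j⟩ _
    rfl

/-! ### Consequences of a large radius -/

theorem IsLargeRadius.pos {p q R : ℝ} (hR : IsLargeRadius p q R) : 0 < R :=
  zero_lt_one.trans hR.1

theorem IsLargeRadius.one_sub_ne_zero {p q R : ℝ} (hR : IsLargeRadius p q R) {z : ℂ}
    (hz : R ≤ ‖z‖) : 1 - z ≠ 0 := by
  intro h
  rw [← sub_eq_zero.1 h, norm_one] at hz
  exact absurd hR.1 (not_lt.2 hz)

theorem IsLargeRadius.ne_zero {p q R : ℝ} (hR : IsLargeRadius p q R) {z : ℂ}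
    (hz : R ≤ ‖z‖) : z ≠ 0 :=
  norm_pos_iff.1 (hR.pos.trans_le hz)

/-- For `ξ = -R` the equation `f(ξ, ξ') = 0` has the solution `ξ' = (1 + p/R)/q`, which must
therefore have modulus below `R`. -/
theorem IsLargeRadius.lt_mul {p q R : ℝ} (hR : IsLargeRadius p q R) (hp : 0 ≤ p) (hq : 0 < q) :
    1 + p / R < q * R := by
  by_contra h
  push Not at h
  have hR0 := hR.pos
  refine hR.2 (-R : ℝ) (((1 + p / R) / q : ℝ)) ?_ ?_ ?_
  · rw [Complex.norm_real, Real.norm_eq_abs, abs_neg, abs_of_pos hR0]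
  · rw [Complex.norm_real, Real.norm_of_nonneg (by positivity), le_div_iff₀ hq]
    linarith
  · unfold fpq
    rw [← Complex.ofReal_mul, ← Complex.ofReal_mul, ← Complex.ofReal_add, ← Complex.ofReal_sub,
      Complex.ofReal_eq_zero]
    field_simp
    ring

/-- This places the zero `p / (1 - q z)` of `f(·, z)` inside the contour. -/
theorem IsLargeRadius.lt_norm {p q R : ℝ} (hR : IsLargeRadius p q R) (hp : 0 ≤ p) (hq : 0 < q)
    {z : ℂ} (hz : R ≤ ‖z‖) : p / R < ‖1 - q * z‖ := by
  have h1 := hR.lt_mul hp hq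
  have h2 : ‖(q : ℂ) * z‖ - ‖(1 : ℂ)‖ ≤ ‖1 - (q : ℂ) * z‖ := by
    rw [norm_sub_rev]; exact norm_sub_norm_le _ _
  rw [norm_mul, Complex.norm_real, Real.norm_of_nonneg hq.le, norm_one] at h2
  nlinarith

theorem IsLargeRadius.one_sub_mul_ne_zero {p q R : ℝ} (hR : IsLargeRadius p q R) (hp : 0 ≤ p)
    (hq : 0 < q) {z : ℂ} (hz : R ≤ ‖z‖) : 1 - q * z ≠ 0 := by
  have h1 := hR.lt_norm hp hq hz
  have h2 : 0 ≤ p / R := div_nonneg hp hR.pos.le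
  exact norm_pos_iff.1 (h2.trans_lt h1)

/-! ### The time-independent integrand -/

/-- The factor `(ξ' - ξ) / f(ξ, ξ')`. -/
noncomputable def coupling (p q : ℝ) (ξ ξ' : ℂ) : ℂ := (ξ' - ξ) / fpq p q ξ ξ'

/-- The rational function `∏_{i<j} (ξⱼ - ξᵢ) / f(ξᵢ, ξⱼ) · ∏ᵢ ξᵢ ^ bᵢ / (1 - ξᵢ)`. -/
noncomputable def kernelFun (p q : ℝ) {k : ℕ} (b : Fin k → ℤ) (ξ : Fin k → ℂ) : ℂ :=
  (∏ i, ∏ j ∈ Finset.Ioi i, coupling p q (ξ i) (ξ j)) * ∏ i, ((1 - ξ i)⁻¹ * ξ i ^ b i)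

/-- The part of `kernelFun` that does not involve the variable `ξⱼ`. -/
noncomputable def kernelCofactor (p q : ℝ) {k : ℕ} (b : Fin k → ℤ) (j : Fin k) (ξ : Fin k → ℂ) :
    ℂ :=
  (∏ i ∈ Finset.univ.erase j, ∏ l ∈ (Finset.Ioi i).erase j, coupling p q (ξ i) (ξ l)) *
    ∏ i ∈ Finset.univ.erase j, ((1 - ξ i)⁻¹ * ξ i ^ b i)

theorem kernelCofactor_update (p q : ℝ) {k : ℕ} (b : Fin k → ℤ) (j : Fin k) (ξ : Fin k → ℂ)
    (z : ℂ) : kernelCofactor p q b j (Function.update ξ j z) = kernelCofactor p q b j ξ := by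
  unfold kernelCofactor
  congr 1
  · refine Finset.prod_congr rfl fun i hi => Finset.prod_congr rfl fun l hl => ?_
    rw [Function.update_of_ne (Finset.ne_of_mem_erase hi),
      Function.update_of_ne (Finset.ne_of_mem_erase hl)]
  · refine Finset.prod_congr rfl fun i hi => ?_
    rw [Function.update_of_ne (Finset.ne_of_mem_erase hi)]

theorem kernelFun_eq_cofactor_mul (p q : ℝ) {k : ℕ} (b : Fin k → ℤ) (j : Fin k) (ξ : Fin k → ℂ) :
    kernelFun p q b ξ = kernelCofactor p q b j ξ *
      ((∏ l ∈ Finset.Iio j, coupling p q (ξ l) (ξ j)) *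
        (∏ l ∈ Finset.Ioi j, coupling p q (ξ j) (ξ l)) * ((1 - ξ j)⁻¹ * ξ j ^ b j)) := by
  unfold kernelFun kernelCofactor
  rw [prod_pairs_split (fun i l => coupling p q (ξ i) (ξ l)) j,
    ← Finset.mul_prod_erase _ (fun i => (1 - ξ i)⁻¹ * ξ i ^ b i) (Finset.mem_univ j)]
  ring

theorem kernelFun_update (p q : ℝ) {k : ℕ} (b : Fin k → ℤ) (j : Fin k) (ξ : Fin k → ℂ) (z : ℂ) :
    kernelFun p q b (Function.update ξ j z) = kernelCofactor p q b j ξ *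
      ((∏ l ∈ Finset.Iio j, coupling p q (ξ l) z) *
        (∏ l ∈ Finset.Ioi j, coupling p q z (ξ l)) * ((1 - z)⁻¹ * z ^ b j)) := by
  rw [kernelFun_eq_cofactor_mul p q b j, kernelCofactor_update, Function.update_self]
  congr 3
  · refine Finset.prod_congr rfl fun l hl => ?_
    rw [Function.update_of_ne (Finset.mem_Iio.1 hl).ne]
  · refine Finset.prod_congr rfl fun l hl => ?_
    rw [Function.update_of_ne (Finset.mem_Ioi.1 hl).ne']

theorem kernelFun_cons (p q : ℝ) {k : ℕ} (n : ℤ) (b : Fin k → ℤ) (z : ℂ) (ζ : Fin k → ℂ) :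
    kernelFun p q (Fin.cons n b : Fin (k + 1) → ℤ) (Fin.cons z ζ : Fin (k + 1) → ℂ) =
      ((∏ j, coupling p q z (ζ j)) * ((1 - z)⁻¹ * z ^ n)) * kernelFun p q b ζ := by
  unfold kernelFun
  rw [Fin.prod_univ_succ, Fin.prod_univ_succ, Fin.prod_Ioi_zero]
  simp only [Fin.prod_Ioi_succ, Fin.cons_zero, Fin.cons_succ]
  ring

section Continuity

variable {p q R : ℝ} {k : ℕ}

theorem continuousOn_coupling_apply (hR : IsLargeRadius p q R) (i j : Fin k) :
    ContinuousOn (fun ξ : Fin k → ℂ => coupling p q (ξ i) (ξ j)) {ξ | ∀ i, ‖ξ i‖ = R} := by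
  unfold coupling fpq
  refine ContinuousOn.div (by fun_prop) (by fun_prop) fun ξ hξ => ?_
  exact hR.2 _ _ (hξ i).ge (hξ j).ge

theorem continuousOn_zpow_apply (hR : IsLargeRadius p q R) (i : Fin k) (n : ℤ) :
    ContinuousOn (fun ξ : Fin k → ℂ => ξ i ^ n) {ξ | ∀ i, ‖ξ i‖ = R} :=
  ContinuousOn.zpow₀ (by fun_prop) _ fun ξ hξ => Or.inl (hR.ne_zero (hξ i).ge)

theorem continuousOn_one_sub_inv_apply (hR : IsLargeRadius p q R) (i : Fin k) :
    ContinuousOn (fun ξ : Fin k → ℂ => (1 - ξ i)⁻¹) {ξ | ∀ i, ‖ξ i‖ = R} :=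
  ContinuousOn.inv₀ (by fun_prop) fun ξ hξ => hR.one_sub_ne_zero (hξ i).ge

theorem continuousOn_kernelCofactor (hR : IsLargeRadius p q R) (b : Fin k → ℤ) (j : Fin k) :
    ContinuousOn (kernelCofactor p q b j) {ξ | ∀ i, ‖ξ i‖ = R} := by
  unfold kernelCofactor
  refine ContinuousOn.mul ?_ ?_
  · exact continuousOn_finsetProd _ fun i _ => continuousOn_finsetProd _ fun l _ =>
      continuousOn_coupling_apply hR i l
  · exact continuousOn_finsetProd _ fun i _ =>
      (continuousOn_one_sub_inv_apply hR i).mul (continuousOn_zpow_apply hR i _)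

theorem continuousOn_kernelFun (hR : IsLargeRadius p q R) (b : Fin k → ℤ) :
    ContinuousOn (kernelFun p q b) {ξ | ∀ i, ‖ξ i‖ = R} := by
  unfold kernelFun
  refine ContinuousOn.mul ?_ ?_
  · exact continuousOn_finsetProd _ fun i _ => continuousOn_finsetProd _ fun l _ =>
      continuousOn_coupling_apply hR i l
  · exact continuousOn_finsetProd _ fun i _ =>
      (continuousOn_one_sub_inv_apply hR i).mul (continuousOn_zpow_apply hR i _)

end Continuity

/-! ### Limits at infinity of the factors -/

section Limits

variable {p q R : ℝ}

theorem tendsto_coupling_right (hq : q ≠ 0) {w : ℂ} (hw : w ≠ 0) :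
    ∃ c, Tendsto (fun z => coupling p q w z) (Bornology.cobounded ℂ) (𝓝 c) := by
  refine ⟨_, (tendsto_moebius_cobounded 1 (-w) (p - w) (c := q * w) ?_).congr fun z => ?_⟩
  · exact mul_ne_zero (by exact_mod_cast hq) hw
  · unfold coupling fpq
    congr 1 <;> ring

theorem tendsto_coupling_left {w : ℂ} (hw : 1 - q * w ≠ 0) :
    ∃ c, Tendsto (fun z => coupling p q z w) (Bornology.cobounded ℂ) (𝓝 c) := by
  refine ⟨_, (tendsto_moebius_cobounded (-1) w p (c := -(1 - q * w)) (neg_ne_zero.2 hw)).congr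
    fun z => ?_⟩
  unfold coupling fpq
  congr 1 <;> ring

theorem tendsto_fpq_div {w : ℂ} (hw : 1 - q * w ≠ 0) :
    ∃ c, Tendsto (fun z => fpq p q w z / fpq p q z w) (Bornology.cobounded ℂ) (𝓝 c) := by
  refine ⟨_, (tendsto_moebius_cobounded (q * w) (p - w) p (c := -(1 - q * w))
    (neg_ne_zero.2 hw)).congr fun z => ?_⟩
  unfold fpq
  congr 1 <;> ring

theorem exists_tendsto_prod {ι : Type*} (s : Finset ι) {f : ι → ℂ → ℂ} {l : Filter ℂ}
    (h : ∀ i ∈ s, ∃ c, Tendsto (f i) l (𝓝 c)) :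
    ∃ c, Tendsto (fun z => ∏ i ∈ s, f i z) l (𝓝 c) := by
  choose! c hc using h
  exact ⟨_, tendsto_finsetProd s hc⟩

theorem differentiableAt_fpq_left (w z : ℂ) : DifferentiableAt ℂ (fun z => fpq p q z w) z := by
  unfold fpq; fun_prop

theorem differentiableAt_fpq_right (w z : ℂ) : DifferentiableAt ℂ (fun z => fpq p q w z) z := by
  unfold fpq; fun_prop

theorem differentiableAt_coupling_left (hR : IsLargeRadius p q R) {w z : ℂ} (hw : R ≤ ‖w‖)
    (hz : R ≤ ‖z‖) : DifferentiableAt ℂ (fun z => coupling p q z w) z :=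
  DifferentiableAt.div (by fun_prop) (differentiableAt_fpq_left w z) (hR.2 _ _ hz hw)

theorem differentiableAt_coupling_right (hR : IsLargeRadius p q R) {w z : ℂ} (hw : R ≤ ‖w‖)
    (hz : R ≤ ‖z‖) : DifferentiableAt ℂ (fun z => coupling p q w z) z :=
  DifferentiableAt.div (by fun_prop) (differentiableAt_fpq_right w z) (hR.2 _ _ hw hz)

end Limits

/-! ### The integrals of the rational kernel -/

section Kernel

variable {p q R : ℝ} {k : ℕ}

/-- The contour integral of `kernelFun`. -/
noncomputable def kernelIntegral (p q R : ℝ) {k : ℕ} (b : Fin k → ℤ) : ℂ :=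
  contourIntegral R (kernelFun p q b)

theorem torusIntegrable_kernelFun (hR : IsLargeRadius p q R) (b : Fin k → ℤ) :
    TorusIntegrable (kernelFun p q b) 0 (fun _ => R) :=
  torusIntegrable_of_continuousOn hR.pos.le (continuousOn_kernelFun hR b)

/-- A negative exponent makes the integral vanish. -/
theorem kernelIntegral_eq_zero (hp : 0 ≤ p) (hq : 0 < q) (hR : IsLargeRadius p q R)
    {b : Fin k → ℤ} {j : Fin k} (hj : b j < 0) : kernelIntegral p q R b = 0 := by
  unfold kernelIntegral contourIntegral
  rw [torusIntegral_eq_zero_of_update hR.pos.le (torusIntegrable_kernelFun hR b) j, mul_zero]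
  intro ξ hξ
  simp only [kernelFun_update]
  rw [circleIntegral.integral_const_mul, circleIntegral_eq_zero_of_tendsto hR.pos, mul_zero]
  · intro z hz
    refine ((DifferentiableAt.fun_finsetProd fun l _ => ?_).mul
      (DifferentiableAt.fun_finsetProd fun l _ => ?_)).mul (DifferentiableAt.mul ?_ ?_)
    · exact differentiableAt_coupling_right hR (hξ l).ge hz
    · exact differentiableAt_coupling_left hR (hξ l).ge hz
    · exact DifferentiableAt.inv (by fun_prop) (hR.one_sub_ne_zero hz)
    · exact differentiableAt_id.zpow (Or.inl (hR.ne_zero hz))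
  -- The couplings and `z / (1 - z)` have finite limits at infinity, so the negative power forces
  -- decay.
  · obtain ⟨c₁, h₁⟩ := exists_tendsto_prod (Finset.Iio j) (l := Bornology.cobounded ℂ)
      (f := fun l z => coupling p q (ξ l) z)
      fun l _ => tendsto_coupling_right hq.ne' (hR.ne_zero (hξ l).ge)
    obtain ⟨c₂, h₂⟩ := exists_tendsto_prod (Finset.Ioi j) (l := Bornology.cobounded ℂ)
      (f := fun l z => coupling p q z (ξ l))
      fun l _ => tendsto_coupling_left (hR.one_sub_mul_ne_zero hp hq (hξ l).ge)
    have h₃ := tendsto_moebius_cobounded 1 0 1 (c := -1) (by norm_num)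
    have h₄ := (h₁.mul h₂).mul (h₃.mul (tendsto_zpow_cobounded hj))
    rw [mul_zero, mul_zero] at h₄
    refine h₄.congr fun z => ?_
    rw [show (1 * z + 0) / (-1 * z + 1) = z * (1 - z)⁻¹ by rw [div_eq_mul_inv]; ring_nf]
    ring

/-- The residue of `z ^ n / (1 - z) · ∏ₗ (ζₗ - z) / f(z, ζₗ)` at the zero of `f(z, ζⱼ)`. -/
noncomputable def couplingResidue (p q : ℝ) (n : ℕ) (ζ : Fin k → ℂ) (j : Fin k) : ℂ :=
  (p / (1 - q * ζ j)) ^ n / (1 - p / (1 - q * ζ j)) *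
      ((ζ j - p / (1 - q * ζ j)) / -(1 - q * ζ j)) *
    ∏ l ∈ Finset.univ.erase j, (ζ l - p / (1 - q * ζ j)) / fpq p q (p / (1 - q * ζ j)) (ζ l)

theorem prod_erase_some {k : ℕ} (F : Option (Fin k) → ℂ) (i : Fin k) :
    ∏ o ∈ Finset.univ.erase (some i), F o = F none * ∏ l ∈ Finset.univ.erase i, F (some l) := by
  have : Finset.univ.erase (some i) = Finset.insertNone (Finset.univ.erase i) := by
    ext o
    cases o <;> simp
  rw [this, Finset.prod_insertNone]

theorem prod_erase_none {k : ℕ} (F : Option (Fin k) → ℂ) :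
    ∏ o ∈ Finset.univ.erase none, F o = ∏ l, F (some l) := by
  have : (Finset.univ.erase none : Finset (Option (Fin k))) =
      Finset.univ.map Function.Embedding.some := by
    ext o
    cases o <;> simp
  rw [this, Finset.prod_map]
  rfl

/-- The poles are `1` and the zeros `p / (1 - q ζⱼ)` of `f(z, ζⱼ)`, all inside and distinct. As
`f(1, ζ) = q (ζ - 1)`, every coupling equals `1/q` at `z = 1`. -/
theorem circleIntegral_prod_coupling (hp : 0 < p) (hq : 0 < q) (hpq : p + q = 1)
    (hR : IsLargeRadius p q R) (n : ℕ) (ζ : Fin k → ℂ) (hζ : ∀ i, ‖ζ i‖ = R)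
    (hinj : Function.Injective ζ) :
    ∮ z in C(0, R), (∏ j, coupling p q z (ζ j)) * ((1 - z)⁻¹ * z ^ (n : ℤ)) =
      2 * Real.pi * Complex.I * (-((q : ℂ) ^ k)⁻¹ + ∑ j, couplingResidue p q n ζ j) := by
  have hpC : (p : ℂ) ≠ 0 := by exact_mod_cast hp.ne'
  have hqC : (q : ℂ) ≠ 0 := by exact_mod_cast hq.ne'
  have hpqC : (p : ℂ) + q = 1 := by exact_mod_cast hpq
  have hc : ∀ l, 1 - q * ζ l ≠ 0 := fun l => hR.one_sub_mul_ne_zero hp.le hq (hζ l).ge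
  have h1 : ∀ l, 1 - ζ l ≠ 0 := fun l => hR.one_sub_ne_zero (hζ l).ge
  -- `none` indexes the pole at `1`, `some l` the zero of `f(·, ζ l)`.
  set v : Option (Fin k) → ℂ := fun o => o.elim 1 fun l => p / (1 - q * ζ l) with hv
  have hvinj : Function.Injective v := by
    rintro (_ | i) (_ | j) h
    · rfl
    · simp only [hv, Option.elim] at h
      rw [eq_div_iff (hc j)] at h
      refine absurd ?_ (h1 j)
      have : (q : ℂ) * (1 - ζ j) = 0 := by linear_combination h + hpqC
      exact (mul_eq_zero.1 this).resolve_left hqC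
    · simp only [hv, Option.elim] at h
      rw [div_eq_iff (hc i)] at h
      refine absurd ?_ (h1 i)
      have : (q : ℂ) * (1 - ζ i) = 0 := by linear_combination -h + hpqC
      exact (mul_eq_zero.1 this).resolve_left hqC
    · simp only [hv, Option.elim] at h
      rw [div_eq_div_iff (hc i) (hc j)] at h
      have : (p : ℂ) * q * (ζ i - ζ j) = 0 := by linear_combination h
      have := (mul_eq_zero.1 this).resolve_left (mul_ne_zero hpC hqC)
      rw [hinj (sub_eq_zero.1 this)]
  have hvR : ∀ o ∈ Finset.univ, ‖v o‖ < R := by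
    rintro (_ | l) -
    · simpa [hv] using hR.1
    · simp only [hv, Option.elim, norm_div, Complex.norm_real, Real.norm_of_nonneg hp.le]
      have := hR.lt_norm hp.le hq (hζ l).ge
      rw [div_lt_iff₀ hR.pos] at this
      rw [div_lt_iff₀ (norm_pos_iff.2 (hc l))]
      linarith
  -- The constant collects the leading coefficients of the `f(·, ζ l)` and the sign of `1 - z`, so
  -- that the denominator is monic.
  let P : Polynomial ℂ := Polynomial.C (-∏ l, (-(1 - q * ζ l))⁻¹) * Polynomial.X ^ n *
    ∏ l, (Polynomial.C (ζ l) - Polynomial.X)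
  have hP : ∀ z, P.eval z = (-∏ l, (-(1 - q * ζ l))⁻¹) * z ^ n * ∏ l, (ζ l - z) := by
    intro z
    simp [P, Polynomial.eval_prod]
  have hf : ∀ l z, fpq p q z (ζ l) = -(1 - q * ζ l) * (z - p / (1 - q * ζ l)) := by
    intro l z
    have := hc l
    unfold fpq
    field_simp
    ring
  have hres := circleIntegral_polynomial_div_prod Finset.univ v hvinj.injOn P hvR hR.pos
  have hlhs : ∀ z, P.eval z / ∏ o, (z - v o) =
      (∏ j, coupling p q z (ζ j)) * ((1 - z)⁻¹ * z ^ (n : ℤ)) := by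
    intro z
    rw [hP, Fintype.prod_option]
    simp only [hv, Option.elim, coupling, hf, Finset.prod_div_distrib, Finset.prod_mul_distrib,
      Finset.prod_inv_distrib, zpow_natCast]
    rw [show (1 - z)⁻¹ = -(z - 1)⁻¹ by rw [← inv_neg, neg_sub]]
    simp only [div_eq_mul_inv, mul_inv]
    ring
  simp only [hlhs] at hres
  rw [hres, Fintype.sum_option, prod_erase_none]
  congr 2
  · rw [hP]
    simp only [hv, Option.elim, one_pow, mul_one]
    rw [neg_mul, neg_div, ← Finset.prod_mul_distrib, ← Finset.prod_div_distrib]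
    congr 1
    rw [← inv_pow, Finset.prod_congr rfl (g := fun _ => (q : ℂ)⁻¹), Finset.prod_const,
      Finset.card_univ, Fintype.card_fin]
    intro l _
    have h3 : 1 - p / (1 - q * ζ l) = q * (1 - ζ l) / (1 - q * ζ l) := by
      rw [eq_div_iff (hc l), sub_mul, div_mul_cancel₀ _ (hc l)]
      linear_combination -hpqC
    rw [h3]
    have := hc l
    have := h1 l
    field_simp
    ring
  · refine Finset.sum_congr rfl fun j _ => ?_
    rw [prod_erase_some, hP]
    simp only [couplingResidue, hv, Option.elim, hf]
    rw [← Finset.mul_prod_erase _ (fun l => (-(1 - q * ζ l))⁻¹) (Finset.mem_univ j),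
      ← Finset.mul_prod_erase _ (fun l => ζ l - _) (Finset.mem_univ j)]
    simp only [Finset.prod_div_distrib, Finset.prod_mul_distrib, Finset.prod_inv_distrib]
    rw [show 1 - p / (1 - q * ζ j) = -(p / (1 - q * ζ j) - 1) by ring]
    simp only [div_eq_mul_inv, mul_inv, inv_neg]
    ring

/-- What remains of `couplingResidue · kernelFun` after cancellation: a function without poles in
`ζⱼ` outside the contour. -/
noncomputable def residueKernel (p q : ℝ) (n : ℕ) (b : Fin k → ℤ) (j : Fin k) (ζ : Fin k → ℂ) : ℂ :=
  kernelCofactor p q b j ζ *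
    ((∏ _l ∈ Finset.Iio j, ((p : ℂ) * q)⁻¹) *
      (∏ l ∈ Finset.Ioi j, -((p : ℂ) * q)⁻¹ * (fpq p q (ζ l) (ζ j) / fpq p q (ζ j) (ζ l))) *
      (-(q : ℂ)⁻¹ * (p / (1 - q * ζ j)) ^ n * ((q * ζ j - p) / (1 - q * ζ j)) *
        ((1 - ζ j)⁻¹ * ζ j ^ b j)))

/-- At `z = p / (1 - q ζⱼ)`, `f(z, ζₗ)` is proportional to `ζₗ - ζⱼ` and `ζₗ - z` to `f(ζₗ, ζⱼ)`.
For `l < j` the coupling in the kernel cancels both up to a constant; for `l > j` it cancels the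
difference and leaves a ratio of two values of `f`. -/
theorem couplingResidue_mul_kernelFun (hp : 0 < p) (hq : 0 < q) (hpq : p + q = 1)
    (hR : IsLargeRadius p q R) (n : ℕ) (b : Fin k → ℤ) (j : Fin k) (ζ : Fin k → ℂ)
    (hζ : ∀ i, ‖ζ i‖ = R) (hinj : Function.Injective ζ) :
    couplingResidue p q n ζ j * kernelFun p q b ζ = residueKernel p q n b j ζ := by
  have hpC : (p : ℂ) ≠ 0 := by exact_mod_cast hp.ne'
  have hqC : (q : ℂ) ≠ 0 := by exact_mod_cast hq.ne'
  have hpqC : (p : ℂ) + q = 1 := by exact_mod_cast hpq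
  have hc := hR.one_sub_mul_ne_zero hp.le hq (hζ j).ge
  have h1 := hR.one_sub_ne_zero (hζ j).ge
  have hfactor : ∀ l ∈ Finset.univ.erase j,
      (ζ l - p / (1 - q * ζ j)) / fpq p q (p / (1 - q * ζ j)) (ζ l) =
        -((p : ℂ) * q)⁻¹ * (fpq p q (ζ l) (ζ j) / (ζ l - ζ j)) := by
    intro l hl
    have hne : ζ l - ζ j ≠ 0 := sub_ne_zero.2 fun h => Finset.ne_of_mem_erase hl (hinj h)
    have e1 : fpq p q (p / (1 - q * ζ j)) (ζ l) = p * q * (ζ l - ζ j) / (1 - q * ζ j) := by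
      unfold fpq
      field_simp
      ring
    have e2 : ζ l - p / (1 - q * ζ j) = -fpq p q (ζ l) (ζ j) / (1 - q * ζ j) := by
      unfold fpq
      field_simp
      ring
    rw [e1, e2]
    field_simp
  have hsplit : ∀ F : Fin k → ℂ, ∏ l ∈ Finset.univ.erase j, F l =
      (∏ l ∈ Finset.Iio j, F l) * ∏ l ∈ Finset.Ioi j, F l := by
    intro F
    rw [← Finset.prod_union]
    · refine Finset.prod_congr ?_ fun _ _ => rfl
      ext l
      simp
    · rw [Finset.disjoint_left]
      intro l h1 h2
      exact lt_asymm (Finset.mem_Iio.1 h1) (Finset.mem_Ioi.1 h2)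
  unfold couplingResidue
  rw [Finset.prod_congr rfl hfactor, hsplit, kernelFun_eq_cofactor_mul p q b j]
  have hlow : (∏ _l ∈ Finset.Iio j, ((p : ℂ) * q)⁻¹) =
      (∏ l ∈ Finset.Iio j, -((p : ℂ) * q)⁻¹ * (fpq p q (ζ l) (ζ j) / (ζ l - ζ j))) *
        ∏ l ∈ Finset.Iio j, coupling p q (ζ l) (ζ j) := by
    rw [← Finset.prod_mul_distrib]
    refine Finset.prod_congr rfl fun l hl => ?_
    have hne : ζ l - ζ j ≠ 0 := sub_ne_zero.2 fun h => (Finset.mem_Iio.1 hl).ne (hinj h)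
    have hf := hR.2 _ _ (hζ l).ge (hζ j).ge
    unfold coupling
    rw [← neg_sub (ζ l) (ζ j)]
    field_simp
  have hhigh : (∏ l ∈ Finset.Ioi j,
        -((p : ℂ) * q)⁻¹ * (fpq p q (ζ l) (ζ j) / fpq p q (ζ j) (ζ l))) =
      (∏ l ∈ Finset.Ioi j, -((p : ℂ) * q)⁻¹ * (fpq p q (ζ l) (ζ j) / (ζ l - ζ j))) *
        ∏ l ∈ Finset.Ioi j, coupling p q (ζ j) (ζ l) := by
    rw [← Finset.prod_mul_distrib]
    refine Finset.prod_congr rfl fun l hl => ?_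
    have hne : ζ l - ζ j ≠ 0 := sub_ne_zero.2 fun h => (Finset.mem_Ioi.1 hl).ne' (hinj h)
    unfold coupling
    field_simp
  have hmid : (1 - p / (1 - q * ζ j))⁻¹ * ((ζ j - p / (1 - q * ζ j)) / -(1 - q * ζ j)) =
      -(q : ℂ)⁻¹ * ((q * ζ j - p) / (1 - q * ζ j)) := by
    have e3 : 1 - p / (1 - q * ζ j) = q * (1 - ζ j) / (1 - q * ζ j) := by
      rw [eq_div_iff hc, sub_mul, div_mul_cancel₀ _ hc]
      linear_combination -hpqC
    have e4 : ζ j - p / (1 - q * ζ j) = (1 - ζ j) * (q * ζ j - p) / (1 - q * ζ j) := by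
      rw [eq_div_iff hc, sub_mul, div_mul_cancel₀ _ hc]
      linear_combination -ζ j * hpqC
    rw [e3, e4]
    field_simp
  unfold residueKernel
  rw [hlow, hhigh]
  rw [div_eq_mul_inv (_ ^ n) (1 - _), mul_assoc (_ ^ n), hmid]
  ring

theorem continuousOn_residueKernel (hp : 0 ≤ p) (hq : 0 < q) (hR : IsLargeRadius p q R)
    (n : ℕ) (b : Fin k → ℤ) (j : Fin k) :
    ContinuousOn (residueKernel p q n b j) {ξ | ∀ i, ‖ξ i‖ = R} := by
  have hc : ∀ ζ : Fin k → ℂ, ζ ∈ {ξ : Fin k → ℂ | ∀ i, ‖ξ i‖ = R} → 1 - q * ζ j ≠ 0 :=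
    fun ζ hζ => hR.one_sub_mul_ne_zero hp hq (hζ j).ge
  unfold residueKernel
  refine (continuousOn_kernelCofactor hR b j).mul (ContinuousOn.mul (continuousOn_const.mul
    (continuousOn_finsetProd _ fun l _ => continuousOn_const.mul ?_))
    (ContinuousOn.mul (ContinuousOn.mul (continuousOn_const.mul ?_) ?_)
    ((continuousOn_one_sub_inv_apply hR j).mul (continuousOn_zpow_apply hR j _))))
  · unfold fpq
    exact ContinuousOn.div (by fun_prop) (by fun_prop) fun ζ hζ => hR.2 _ _ (hζ j).ge (hζ l).ge
  · exact (ContinuousOn.div (by fun_prop) (by fun_prop) hc).pow n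
  · exact ContinuousOn.div (by fun_prop) (by fun_prop) hc

/-- In `ζⱼ` there are no poles outside the contour. The ratios of `f` have limits at infinity and
the rest is `O(z ^ (bⱼ - n - 1))`, so the contour can be moved to infinity. -/
theorem torusIntegral_residueKernel (hp : 0 ≤ p) (hq : 0 < q) (hR : IsLargeRadius p q R)
    (n : ℕ) (b : Fin k → ℤ) {j : Fin k} (hj : b j < n) :
    (∯ ζ in T((0 : Fin k → ℂ), fun _ => R), residueKernel p q n b j ζ) = 0 := by
  refine torusIntegral_eq_zero_of_update hR.pos.le
    (torusIntegrable_of_continuousOn hR.pos.le (continuousOn_residueKernel hp hq hR n b j)) j ?_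
  intro ζ hζ
  have hupd : ∀ z, residueKernel p q n b j (Function.update ζ j z) = kernelCofactor p q b j ζ *
    ((∏ _l ∈ Finset.Iio j, ((p : ℂ) * q)⁻¹) *
      (∏ l ∈ Finset.Ioi j, -((p : ℂ) * q)⁻¹ * (fpq p q (ζ l) z / fpq p q z (ζ l))) *
      (-(q : ℂ)⁻¹ * (p / (1 - q * z)) ^ n * ((q * z - p) / (1 - q * z)) *
        ((1 - z)⁻¹ * z ^ b j))) := by
    intro z
    unfold residueKernel
    rw [kernelCofactor_update, Function.update_self]
    congr 3
    refine Finset.prod_congr rfl fun l hl => ?_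
    rw [Function.update_of_ne (Finset.mem_Ioi.1 hl).ne']
  simp only [hupd]
  rw [circleIntegral.integral_const_mul, circleIntegral_eq_zero_of_tendsto hR.pos, mul_zero]
  · intro z hz
    have hcz := hR.one_sub_mul_ne_zero hp hq hz
    refine ((differentiableAt_const _).mul
      (DifferentiableAt.fun_finsetProd fun l _ => (differentiableAt_const _).mul ?_)).mul
      (DifferentiableAt.mul (DifferentiableAt.mul ((differentiableAt_const _).mul ?_) ?_)
        (DifferentiableAt.mul ?_ ?_))
    · exact (differentiableAt_fpq_right _ _).div (differentiableAt_fpq_left _ _)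
        (hR.2 _ _ hz (hζ l).ge)
    · have h : DifferentiableAt ℂ (fun z : ℂ => (p : ℂ) / (1 - q * z)) z :=
        DifferentiableAt.fun_div (by fun_prop) (by fun_prop) hcz
      exact h.fun_pow n
    · have h : DifferentiableAt ℂ (fun z : ℂ => (q * z - p : ℂ) / (1 - q * z)) z :=
        DifferentiableAt.fun_div (by fun_prop) (by fun_prop) hcz
      exact h
    · exact DifferentiableAt.inv (by fun_prop) (hR.one_sub_ne_zero hz)
    · exact differentiableAt_id.zpow (Or.inl (hR.ne_zero hz))
  · have hqC : -(q : ℂ) ≠ 0 := neg_ne_zero.2 (by exact_mod_cast hq.ne')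
    obtain ⟨c₁, h₁⟩ := exists_tendsto_prod (Finset.Ioi j) (l := Bornology.cobounded ℂ)
      (f := fun l z => -((p : ℂ) * q)⁻¹ * (fpq p q (ζ l) z / fpq p q z (ζ l))) fun l _ => by
        obtain ⟨c, hc⟩ := tendsto_fpq_div (p := p)
          (hR.one_sub_mul_ne_zero hp hq (hζ l).ge)
        exact ⟨_, tendsto_const_nhds.mul hc⟩
    have h₂ := (tendsto_moebius_cobounded p 0 1 hqC).pow n
    have h₃ := tendsto_moebius_cobounded q (-p) 1 hqC
    have h₄ := tendsto_moebius_cobounded 1 0 1 (c := -1) (by norm_num)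
    have h₅ := tendsto_zpow_cobounded (n := b j - n) (by omega)
    have h₆ := ((tendsto_const_nhds (x := ∏ _l ∈ Finset.Iio j, ((p : ℂ) * q)⁻¹)).mul h₁).mul
      (((tendsto_const_nhds (x := -(q : ℂ)⁻¹)).mul h₂).mul h₃ |>.mul (h₄.mul h₅))
    simp only [mul_zero] at h₆
    refine h₆.congr' ?_
    filter_upwards [Bornology.eventually_ne_cobounded (0 : ℂ)] with z hz
    rw [zpow_sub₀ hz, zpow_natCast, show -(q : ℂ) * z + 1 = 1 - q * z by ring,
      show (-1 : ℂ) * z + 1 = 1 - z by ring, show (p : ℂ) * z + 0 = p * z by ring,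
      mul_div_right_comm (p : ℂ) z, mul_pow]
    have : z ^ n ≠ 0 := pow_ne_zero _ hz
    field_simp
    ring

/-- For `p = 0` the poles other than `1` merge at `0`, since `f(z, ζ) = -(1 - ζ) z`. As `k ≤ n`, the
power `z ^ n` cancels them. -/
theorem circleIntegral_prod_coupling_zero (hq : q = 1) (hR : IsLargeRadius 0 q R)
    {n : ℕ} (hn : k ≤ n) (ζ : Fin k → ℂ) (hζ : ∀ i, ‖ζ i‖ = R) :
    ∮ z in C(0, R), (∏ j, coupling 0 q z (ζ j)) * ((1 - z)⁻¹ * z ^ (n : ℤ)) =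
      2 * Real.pi * Complex.I * -((q : ℂ) ^ k)⁻¹ := by
  subst hq
  have h1 : ∀ l, 1 - ζ l ≠ 0 := fun l => hR.one_sub_ne_zero (hζ l).ge
  let P : Polynomial ℂ := Polynomial.C (-∏ l, (-(1 - ζ l))⁻¹) * Polynomial.X ^ (n - k) *
    ∏ l, (Polynomial.C (ζ l) - Polynomial.X)
  have hP : ∀ z, P.eval z = (-∏ l, (-(1 - ζ l))⁻¹) * z ^ (n - k) * ∏ l, (ζ l - z) := by
    intro z
    simp [P, Polynomial.eval_prod]
  have hres := circleIntegral_polynomial_div_prod (Finset.univ : Finset Unit) (fun _ => 1)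
    (Function.injective_of_subsingleton _).injOn P (R := R) (by simpa using hR.1) hR.pos
  have hlhs : ∀ z ∈ Metric.sphere (0 : ℂ) R, P.eval z / ∏ _o : Unit, (z - 1) =
      (∏ j, coupling 0 1 z (ζ j)) * ((1 - z)⁻¹ * z ^ (n : ℤ)) := by
    intro z hz
    have hz0 : z ≠ 0 := hR.ne_zero (by simpa using (mem_sphere_zero_iff_norm.1 hz).ge)
    have hf : ∀ l, fpq 0 1 z (ζ l) = -(1 - ζ l) * z := by
      intro l
      unfold fpq
      push_cast
      ring
    have hzk : z ^ k ≠ 0 := pow_ne_zero _ hz0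
    rw [hP]
    simp only [coupling, hf, Finset.prod_div_distrib, Finset.prod_mul_distrib, Finset.prod_const,
      Finset.card_univ, Fintype.card_fin, Finset.prod_inv_distrib, zpow_natCast, Fintype.card_unit,
      pow_one]
    rw [show (1 - z)⁻¹ = -(z - 1)⁻¹ by rw [← inv_neg, neg_sub], pow_sub₀ _ hz0 hn]
    simp only [div_eq_mul_inv, mul_inv]
    ring
  rw [circleIntegral.integral_congr hR.pos.le hlhs] at hres
  rw [hres]
  congr 1
  simp only [Finset.univ_unique, Finset.sum_singleton, Finset.erase_singleton, Finset.prod_empty,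
    div_one, hP, one_pow, mul_one, Complex.ofReal_one, inv_one]
  rw [neg_mul, ← Finset.prod_mul_distrib]
  congr 1
  refine Finset.prod_eq_one fun l _ => ?_
  have := h1 l
  rw [← neg_sub 1 (ζ l)]
  exact inv_mul_cancel₀ (neg_ne_zero.2 this)

/-- Removal of the first variable when its exponent dominates all the others. -/
theorem kernelIntegral_cons (hp : 0 ≤ p) (hq : 0 < q) (hpq : p + q = 1)
    (hR : IsLargeRadius p q R) {n : ℕ} (hn : k ≤ n) {b : Fin k → ℤ} (hb : ∀ j, b j < n) :
    kernelIntegral p q R (Fin.cons (n : ℤ) b : Fin (k + 1) → ℤ) =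
      -((q : ℂ) ^ k)⁻¹ * kernelIntegral p q R b := by
  have h2pi : (2 * (Real.pi : ℂ) * Complex.I) ≠ 0 := Complex.two_pi_I_ne_zero
  unfold kernelIntegral contourIntegral
  rw [torusIntegral_insertNth (torusIntegrable_kernelFun hR _) 0]
  have hinner : ∀ ζ : Fin k → ℂ, (∮ z in C(0, R), kernelFun p q (Fin.cons (n : ℤ) b)
      (Fin.insertNth (α := fun _ => ℂ) 0 z ζ)) =
      (∮ z in C(0, R), (∏ j, coupling p q z (ζ j)) * ((1 - z)⁻¹ * z ^ (n : ℤ))) *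
        kernelFun p q b ζ := by
    intro ζ
    simp only [Fin.insertNth_zero', kernelFun_cons]
    simp only [mul_comm _ (kernelFun p q b ζ)]
    rw [circleIntegral.integral_const_mul]
  simp only [hinner]
  rcases hp.eq_or_lt with rfl | hp
  · rw [torusIntegral_congr (g := fun ζ => (2 * Real.pi * Complex.I * -((q : ℂ) ^ k)⁻¹) *
      kernelFun 0 q b ζ) hR.pos.le fun ζ hζ => by
        rw [circleIntegral_prod_coupling_zero (by linarith) hR hn ζ hζ], torusIntegral_const_mul,
      pow_succ]
    field_simp
  -- Distinct `ζ j` are available only almost everywhere, but the simplified residue terms are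
  -- continuous on the whole torus.
  · rw [torusIntegral_congr_ae (g := fun ζ => (2 * Real.pi * Complex.I) * (-((q : ℂ) ^ k)⁻¹ *
      kernelFun p q b ζ + ∑ j, residueKernel p q n b j ζ)), torusIntegral_const_mul,
      torusIntegral_add, torusIntegral_const_mul]
    · have hsum : (∯ ζ in T((0 : Fin k → ℂ), fun _ => R), ∑ j, residueKernel p q n b j ζ) = 0 := by
        unfold torusIntegral
        simp only [Finset.smul_sum]
        rw [integral_finsetSum]
        · refine Finset.sum_eq_zero fun j _ => ?_
          exact torusIntegral_residueKernel hp.le hq hR n b (hb j)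
        · intro j _
          exact (torusIntegrable_of_continuousOn hR.pos.le
            (continuousOn_residueKernel hp.le hq hR n b j)).function_integrable
      rw [hsum, add_zero, pow_succ]
      field_simp
    · exact torusIntegrable_of_continuousOn hR.pos.le
        (continuousOn_const.mul (continuousOn_kernelFun hR b))
    · exact torusIntegrable_of_continuousOn hR.pos.le
        (continuousOn_finsetSum _ fun j _ => continuousOn_residueKernel hp.le hq hR n b j)
    · filter_upwards [ae_torusMap_injective hR.pos.ne'] with θ hθ
      have hnorm := norm_torusMap hR.pos.le θ
      rw [circleIntegral_prod_coupling hp hq hpq hR n _ hnorm hθ, mul_assoc, add_mul,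
        Finset.sum_mul]
      simp only [couplingResidue_mul_kernelFun hp hq hpq hR n b _ _ hnorm hθ]

theorem le_of_strictAnti {k : ℕ} {b : Fin (k + 1) → ℤ} (hb : StrictAnti b) (h0 : ∀ i, 0 ≤ b i) :
    (k : ℤ) ≤ b 0 := by
  induction k with
  | zero => exact_mod_cast h0 0
  | succ k ih =>
    have h1 := ih (b := fun i => b i.succ) (fun i j h => hb (Fin.succ_lt_succ_iff.2 h))
      fun i => h0 _
    have h2 : b (Fin.succ 0) < b 0 := hb (Fin.succ_pos 0)
    push_cast
    change (k : ℤ) ≤ b (Fin.succ 0) at h1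
    omega

/-- The first exponent is always the largest, so the variables can be removed from the left; the
exponents `0, …, k - 1` of `1/q` add up. -/
theorem kernelIntegral_of_strictAnti (hp : 0 ≤ p) (hq : 0 < q) (hpq : p + q = 1)
    (hR : IsLargeRadius p q R) {b : Fin k → ℤ} (hb : StrictAnti b) (h0 : ∀ i, 0 ≤ b i) :
    kernelIntegral p q R b = (-1) ^ k * ((q : ℂ) ^ (k * (k - 1) / 2))⁻¹ := by
  induction k with
  | zero => simp [kernelIntegral, contourIntegral, kernelFun]
  | succ k ih =>
    have hcons : b = Fin.cons ((b 0).toNat : ℤ) fun i => b i.succ := by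
      rw [Int.toNat_of_nonneg (h0 0)]
      exact (Fin.cons_self_tail b).symm
    have hk := le_of_strictAnti hb h0
    rw [hcons, kernelIntegral_cons hp hq hpq hR (by omega) fun j => ?_,
      ih (fun i j h => hb (Fin.succ_lt_succ_iff.2 h)) fun i => h0 _]
    · have : (k + 1) * (k + 1 - 1) / 2 = k * (k - 1) / 2 + k := by
        have := Nat.triangle_succ k
        omega
      rw [this, pow_add (q : ℂ), mul_inv, pow_succ]
      ring
    · rw [Int.toNat_of_nonneg (h0 0)]
      exact hb (Fin.succ_pos j)

end Kernel

/-! ### Identities for `τ`-binomial coefficients -/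

/-- The `τ`-factorial. -/
def tauFactorial (τ : ℝ) (n : ℕ) : ℝ := ∏ i ∈ Finset.range n, ∑ j ∈ Finset.range (i + 1), τ ^ j

theorem tauFactorial_succ (τ : ℝ) (n : ℕ) :
    tauFactorial τ (n + 1) = tauFactorial τ n * ∑ j ∈ Finset.range (n + 1), τ ^ j :=
  Finset.prod_range_succ _ _

/-- Allows cancellation of `τ`-factorials; writing their factors as sums includes `τ = 1`. -/
theorem tauFactorial_pos {τ : ℝ} (hτ : 0 ≤ τ) (n : ℕ) : 0 < tauFactorial τ n := by
  refine Finset.prod_pos fun i _ => ?_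
  rw [Finset.sum_range_succ']
  have : 0 ≤ ∑ j ∈ Finset.range i, τ ^ (j + 1) := Finset.sum_nonneg fun j _ => by positivity
  simp only [pow_zero]
  linarith

theorem tauBinom_zero_right (τ : ℝ) (n : ℕ) : tauBinom τ n 0 = 1 := by
  cases n <;> rfl

theorem tauBinom_self (τ : ℝ) (n : ℕ) : tauBinom τ n n = 1 := by
  induction n with
  | zero => rfl
  | succ n ih => rw [tauBinom, ih, tauBinom_of_lt τ n (n + 1) (by omega)]; ring

theorem tauBinom_mul_tauFactorial (τ : ℝ) (a b : ℕ) :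
    tauBinom τ (a + b) a * tauFactorial τ a * tauFactorial τ b = tauFactorial τ (a + b) := by
  induction a generalizing b with
  | zero => simp [tauBinom_zero_right, tauFactorial]
  | succ a iha =>
    induction b with
    | zero => simp [tauBinom_self, tauFactorial]
    | succ b ihb =>
      have h1 := iha (b + 1)
      have hsum : ∑ j ∈ Finset.range (a + (b + 1) + 1), τ ^ j =
          (∑ j ∈ Finset.range (a + 1), τ ^ j) +
            τ ^ (a + 1) * ∑ j ∈ Finset.range (b + 1), τ ^ j := by
        rw [show a + (b + 1) + 1 = (a + 1) + (b + 1) by ring, Finset.sum_range_add,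
          Finset.mul_sum]
        simp only [pow_add]
      rw [show a + 1 + b = a + (b + 1) by ring] at ihb
      rw [show a + 1 + (b + 1) = a + (b + 1) + 1 by ring, tauBinom, tauFactorial_succ τ (a + (b + 1)),
        hsum]
      rw [tauFactorial_succ τ b] at h1 ⊢
      rw [tauFactorial_succ τ a] at ihb ⊢
      linear_combination (∑ j ∈ Finset.range (a + 1), τ ^ j) * h1 +
        τ ^ (a + 1) * (∑ j ∈ Finset.range (b + 1), τ ^ j) * ihb

/-- The mirror image of the defining recursion, read off from the factorial form. -/
theorem tauBinom_succ_succ' {τ : ℝ} (hτ : 0 ≤ τ) {n k : ℕ} (h : k ≤ n) :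
    tauBinom τ (n + 1) (k + 1) = tauBinom τ n (k + 1) + τ ^ (n - k) * tauBinom τ n k := by
  obtain ⟨b, rfl⟩ := Nat.exists_eq_add_of_le h
  rw [Nat.add_sub_cancel_left]
  obtain _ | b := b
  · simp [tauBinom_self, tauBinom_of_lt]
  have h1 := tauBinom_mul_tauFactorial τ (k + 1) (b + 1)
  have h2 := tauBinom_mul_tauFactorial τ (k + 1) b
  have h3 := tauBinom_mul_tauFactorial τ k (b + 1)
  rw [show k + 1 + b = k + (b + 1) by ring] at h2
  rw [show k + 1 + (b + 1) = k + (b + 1) + 1 by ring, tauFactorial_succ τ (k + (b + 1))] at h1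
  have hsum : ∑ j ∈ Finset.range (k + (b + 1) + 1), τ ^ j =
      (∑ j ∈ Finset.range (b + 1), τ ^ j) + τ ^ (b + 1) * ∑ j ∈ Finset.range (k + 1), τ ^ j := by
    rw [show k + (b + 1) + 1 = (b + 1) + (k + 1) by ring, Finset.sum_range_add, Finset.mul_sum]
    simp only [pow_add]
  rw [hsum] at h1
  have hk := tauFactorial_pos hτ (k + 1)
  have hb := tauFactorial_pos hτ (b + 1)
  refine mul_right_cancel₀ (mul_pos hk hb).ne' ?_
  rw [← mul_assoc, h1]
  rw [tauFactorial_succ τ b] at h3 ⊢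
  rw [tauFactorial_succ τ k] at h2 ⊢
  linear_combination -(∑ j ∈ Finset.range (b + 1), τ ^ j) * h2 -
    τ ^ (b + 1) * (∑ j ∈ Finset.range (k + 1), τ ^ j) * h3

/-- Both sides are the `τ`-multinomial coefficient of `(m, i, j)`. -/
theorem tauBinom_mul_tauBinom {τ : ℝ} (hτ : 0 ≤ τ) (m i j : ℕ) :
    tauBinom τ (m + (i + j)) (m + i) * tauBinom τ (m + i) m =
      tauBinom τ (m + (i + j)) m * tauBinom τ (i + j) i := by
  have h1 := tauBinom_mul_tauFactorial τ (m + i) j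
  have h2 := tauBinom_mul_tauFactorial τ m i
  have h3 := tauBinom_mul_tauFactorial τ m (i + j)
  have h4 := tauBinom_mul_tauFactorial τ i j
  rw [add_assoc] at h1
  have hm := tauFactorial_pos hτ m
  have hi := tauFactorial_pos hτ i
  have hj := tauFactorial_pos hτ j
  refine mul_right_cancel₀ (mul_pos (mul_pos hm hi) hj).ne' ?_
  rw [← h2] at h1
  rw [← h4, ← h1] at h3
  linear_combination -h3

/-- The `τ`-binomial expansion of `∏_{i ≤ n} (1 - x τ^i)` at `x = 1`; here the recursion makes it
telescope. -/
theorem sum_neg_one_pow_mul_tauBinom (τ : ℝ) (n : ℕ) :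
    ∑ j ∈ Finset.range (n + 2), (-1) ^ j * τ ^ (j * (j - 1) / 2) * tauBinom τ (n + 1) j = 0 := by
  have htri : ∀ j : ℕ, (j + 1) * (j + 1 - 1) / 2 = j * (j - 1) / 2 + j := fun j => by
    have := Nat.triangle_succ j
    omega
  rw [Finset.sum_range_succ']
  have hterm : ∀ j, (-1) ^ (j + 1) * τ ^ ((j + 1) * (j + 1 - 1) / 2) * tauBinom τ (n + 1) (j + 1) =
      (-1) ^ (j + 1) * τ ^ ((j + 1 + 1) * (j + 1 + 1 - 1) / 2) * tauBinom τ n (j + 1) -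
      (-1) ^ j * τ ^ ((j + 1) * (j + 1 - 1) / 2) * tauBinom τ n j := by
    intro j
    rw [htri (j + 1), tauBinom]
    ring
  simp only [hterm]
  rw [Finset.sum_range_sub
    (fun j => (-1) ^ j * τ ^ ((j + 1) * (j + 1 - 1) / 2) * tauBinom τ n j),
    tauBinom_of_lt τ n (n + 1) (by omega)]
  simp [tauBinom_zero_right]

/-- Induction on `d`: the mirrored recursion reproduces the sum for `d` plus a remainder, which
`tauBinom_mul_tauBinom` turns into a multiple of the vanishing alternating sum. -/
theorem sum_tauBinom_mul_tauBinom {τ : ℝ} (hτ : 0 ≤ τ) (m d : ℕ) :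
    ∑ j ∈ Finset.range (d + 1), (-1) ^ j * τ ^ (j * (j + 1) / 2) * tauBinom τ (m + j) m *
      tauBinom τ (m + 1 + d) (m + 1 + j) = 1 := by
  induction d with
  | zero => simp [tauBinom_self]
  | succ d ih =>
    have hterm : ∀ j ∈ Finset.range (d + 1 + 1),
        (-1) ^ j * τ ^ (j * (j + 1) / 2) * tauBinom τ (m + j) m *
          tauBinom τ (m + 1 + (d + 1)) (m + 1 + j) =
        (-1) ^ j * τ ^ (j * (j + 1) / 2) * tauBinom τ (m + j) m *
          tauBinom τ (m + 1 + d) (m + 1 + j) +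
        τ ^ (d + 1) * tauBinom τ (m + (d + 1)) m *
          ((-1) ^ j * τ ^ (j * (j - 1) / 2) * tauBinom τ (d + 1) j) := by
      intro j hj
      have hj' : j ≤ d + 1 := Nat.lt_succ_iff.1 (Finset.mem_range.1 hj)
      obtain ⟨i, hi⟩ := Nat.exists_eq_add_of_le hj'
      have hp := tauBinom_succ_succ' hτ (n := m + (d + 1)) (k := m + j) (by omega)
      have ht := tauBinom_mul_tauBinom hτ m j i
      rw [← hi] at ht
      rw [show m + 1 + (d + 1) = m + (d + 1) + 1 by ring, show m + 1 + j = m + j + 1 by ring, hp,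
        show m + 1 + d = m + (d + 1) by ring]
      have he : j * (j + 1) / 2 + (m + (d + 1) - (m + j)) = (d + 1) + j * (j - 1) / 2 := by
        have := Nat.triangle_succ j
        rw [Nat.add_sub_cancel, mul_comm] at this
        omega
      have he' : τ ^ (j * (j + 1) / 2) * τ ^ (m + (d + 1) - (m + j)) =
          τ ^ (d + 1) * τ ^ (j * (j - 1) / 2) := by rw [← pow_add, ← pow_add, he]
      linear_combination (-1) ^ j * tauBinom τ (m + j) m * tauBinom τ (m + (d + 1)) (m + j) * he' +
        (-1) ^ j * τ ^ (d + 1) * τ ^ (j * (j - 1) / 2) * ht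
    rw [Finset.sum_congr rfl hterm, Finset.sum_add_distrib, ← Finset.mul_sum,
      sum_neg_one_pow_mul_tauBinom, mul_zero, add_zero, Finset.sum_range_succ, ih,
      tauBinom_of_lt τ (m + 1 + d) (m + 1 + (d + 1)) (by omega)]
    ring

/-! ### Sums over subsets of an initial segment -/

theorem sig_eq_sum {N : ℕ} (S : Finset (Fin N)) : sig S = ∑ i ∈ S, ((i : ℕ) + 1) := by
  unfold sig
  rw [Finset.card_filter, Finset.sum_product]
  refine Finset.sum_congr rfl fun i _ => ?_
  rw [← Finset.card_filter]
  have : Finset.univ.filter (fun j : Fin N => j ≤ i) = Finset.Iic i := by ext; simp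
  simp only [this, Fin.card_Iic]

/-- The `a`-th smallest element is at least `a`. Hence the natural subtraction of the triangular
number from `sig S` below is never truncated. -/
theorem triangle_le_sig {N : ℕ} (S : Finset (Fin N)) : S.card * (S.card + 1) / 2 ≤ sig S := by
  have h : ∀ a : Fin S.card, (a : ℕ) ≤ (S.orderEmbOfFin rfl a : ℕ) := by
    rintro ⟨a, ha⟩
    induction a with
    | zero => exact Nat.zero_le _
    | succ a ih =>
      have h1 := ih (by omega)
      have h2 : S.orderEmbOfFin rfl ⟨a, by omega⟩ < S.orderEmbOfFin rfl ⟨a + 1, ha⟩ :=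
        (S.orderEmbOfFin rfl).strictMono (Fin.mk_lt_mk.2 (by omega))
      rw [Fin.lt_def] at h2
      simp only at h1 ⊢
      omega
  rw [sig_eq_sum]
  calc S.card * (S.card + 1) / 2 = ∑ a : Fin S.card, ((a : ℕ) + 1) := by
        have := Finset.sum_range_succ' (fun a => a) S.card
        rw [Finset.sum_range_id, Nat.add_sub_cancel, mul_comm, add_zero] at this
        rw [Fin.sum_univ_eq_sum_range (fun a => a + 1), this]
    _ ≤ ∑ a : Fin S.card, ((S.orderEmbOfFin rfl a : ℕ) + 1) :=
        Finset.sum_le_sum fun a _ => Nat.add_le_add_right (h a) 1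
    _ = ∑ i ∈ S, ((i : ℕ) + 1) := by
        conv_rhs => rw [← S.map_orderEmbOfFin_univ rfl, Finset.sum_map]
        rfl

theorem filter_val_lt_succ {N n : ℕ} (h : n < N) :
    Finset.univ.filter (fun i : Fin N => (i : ℕ) < n + 1) =
      insert ⟨n, h⟩ (Finset.univ.filter fun i : Fin N => (i : ℕ) < n) := by
  ext i
  simp only [Finset.mem_filter, Finset.mem_univ, true_and, Finset.mem_insert, Fin.ext_iff]
  omega

theorem card_filter_val_lt {N n : ℕ} (h : n ≤ N) :
    (Finset.univ.filter fun i : Fin N => (i : ℕ) < n).card = n := by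
  rw [Fin.card_filter_val_lt, min_eq_right h]

/-- The generating function of `k`-subsets by their element sum, normalised by its minimum.
Splitting by membership of the last element gives the mirrored recursion. -/
theorem sum_powersetCard_pow_sig {τ : ℝ} (hτ : 0 ≤ τ) {N n : ℕ} (hn : n ≤ N) (k : ℕ) :
    ∑ S ∈ (Finset.univ.filter fun i : Fin N => (i : ℕ) < n).powersetCard k,
      τ ^ (sig S - k * (k + 1) / 2) = tauBinom τ n k := by
  induction n generalizing k with
  | zero =>
    obtain _ | k := k
    · simp [sig, tauBinom]
    · rw [Finset.powersetCard_eq_empty.2 (by simp)]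
      simp [tauBinom]
  | succ n ih =>
    obtain _ | k := k
    · simp [sig, tauBinom]
    have hnot : (⟨n, hn⟩ : Fin N) ∉ Finset.univ.filter fun i : Fin N => (i : ℕ) < n := by simp
    rw [filter_val_lt_succ hn, Finset.powersetCard_succ_insert hnot, Finset.sum_union, ih (by omega),
      Finset.sum_image]
    · rcases lt_or_ge n k with h | h
      · rw [Finset.powersetCard_eq_empty.2 (by rw [card_filter_val_lt (by omega)]; exact h),
          tauBinom_of_lt _ _ _ (by omega), tauBinom_of_lt _ _ _ (by omega)]
        simp
      · rw [tauBinom_succ_succ' hτ h, ← ih (by omega) k, Finset.mul_sum]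
        congr 1
        refine Finset.sum_congr rfl fun S hS => ?_
        rw [Finset.mem_powersetCard] at hS
        have h1 := triangle_le_sig S
        rw [hS.2] at h1
        rw [← pow_add]
        congr 1
        rw [sig_eq_sum (insert _ _), Finset.sum_insert fun h => hnot (hS.1 h), ← sig_eq_sum]
        have := Nat.triangle_succ (k + 1)
        rw [Nat.add_sub_cancel, Nat.add_sub_cancel, mul_comm (k + 1) k] at this
        have h2 := Nat.mul_comm (k + 1 + 1) (k + 1)
        rw [h2, mul_comm k] at this
        rw [mul_comm k] at h1 ⊢
        simp only
        omega
    · intro S hS T hT hST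
      have hS' := fun h => hnot ((Finset.mem_powersetCard.1 hS).1 h)
      have hT' := fun h => hnot ((Finset.mem_powersetCard.1 hT).1 h)
      rw [← Finset.erase_insert hS', ← Finset.erase_insert hT', hST]
    · rw [Finset.disjoint_left]
      intro S hS hS'
      obtain ⟨T, -, rfl⟩ := Finset.mem_image.1 hS'
      exact hnot ((Finset.mem_powersetCard.1 hS).1 (Finset.mem_insert_self _ _))

/-- Exhibits the exponent of `τ` as a natural number, which matters at `τ = 0`, and separates a part
depending on the cardinality alone. -/
theorem weight_exponent_eq {N : ℕ} (S : Finset (Fin N)) {m : ℕ} (hm : m ≤ S.card) :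
    ((m * (m - 1) / 2 : ℕ) : ℤ) + (sig S : ℤ) - (m : ℤ) * (S.card : ℤ) =
      (((S.card - m) * (S.card - m + 1) / 2 + (sig S - S.card * (S.card + 1) / 2) : ℕ) : ℤ) := by
  have h1 := triangle_le_sig S
  obtain ⟨j, hj⟩ := Nat.exists_eq_add_of_le hm
  rw [hj] at h1 ⊢
  rw [Nat.add_sub_cancel_left]
  have e1 : m * (m - 1) / 2 * 2 = m * (m - 1) := Nat.div_two_mul_two_of_even (Nat.even_mul_pred_self m)
  have e2 : j * (j + 1) / 2 * 2 = j * (j + 1) := Nat.div_two_mul_two_of_even (Nat.even_mul_succ_self j)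
  have e3 : (m + j) * (m + j + 1) / 2 * 2 = (m + j) * (m + j + 1) :=
    Nat.div_two_mul_two_of_even (Nat.even_mul_succ_self _)
  have e4 : m * (m - 1) + m = m * m := by
    cases m
    · rfl
    · rw [Nat.add_sub_cancel]; ring
  push_cast [Nat.cast_sub h1]
  zify at e1 e2 e3 e4
  have : (((m + j) * (m + j + 1) / 2 : ℤ)) * 2 = (m + j) * (m + j + 1) := by exact_mod_cast e3
  have : ((j * (j + 1) / 2 : ℤ)) * 2 = j * (j + 1) := by exact_mod_cast e2
  have : (((m * (m - 1) / 2 : ℕ) : ℤ)) * 2 = m * m - m := by push_cast at e1 ⊢; linarith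
  push_cast at this
  nlinarith

/-- The subsets of each size `k` sum to a `τ`-binomial coefficient; the sum over `k = m + j` is then
`sum_tauBinom_mul_tauBinom`. -/
theorem sum_subsets_initial_segment {τ : ℝ} (hτ : 0 ≤ τ) {N n m : ℕ} (hn : n ≤ N) (hm : 1 ≤ m) :
    ∑ S ∈ (Finset.univ.filter fun i : Fin N => (i : ℕ) < n).powerset with m ≤ S.card,
      (-1) ^ S.card * (τ ^ (((m * (m - 1) / 2 : ℕ) : ℤ) + (sig S : ℤ) - (m : ℤ) * (S.card : ℤ)) *
        tauBinom τ (S.card - 1) (m - 1)) = if m ≤ n then (-1) ^ m else 0 := by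
  rw [Finset.sum_filter, Finset.sum_powerset, card_filter_val_lt hn]
  have hk : ∀ k ∈ Finset.range (n + 1),
      ∑ S ∈ (Finset.univ.filter fun i : Fin N => (i : ℕ) < n).powersetCard k,
        (if m ≤ S.card then (-1) ^ S.card *
          (τ ^ (((m * (m - 1) / 2 : ℕ) : ℤ) + (sig S : ℤ) - (m : ℤ) * (S.card : ℤ)) *
          tauBinom τ (S.card - 1) (m - 1)) else 0) =
      if m ≤ k then (-1) ^ k * τ ^ ((k - m) * (k - m + 1) / 2) * tauBinom τ (k - 1) (m - 1) *
        tauBinom τ n k else 0 := by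
    intro k _
    split_ifs with hmk
    · rw [← sum_powersetCard_pow_sig hτ hn k, Finset.mul_sum]
      refine Finset.sum_congr rfl fun S hS => ?_
      have hc := (Finset.mem_powersetCard.1 hS).2
      rw [if_pos (by omega), weight_exponent_eq S (by omega), hc, zpow_natCast, pow_add]
      ring
    · refine Finset.sum_eq_zero fun S hS => ?_
      rw [(Finset.mem_powersetCard.1 hS).2, if_neg hmk]
  rw [Finset.sum_congr rfl hk]
  split_ifs with hmn
  · obtain ⟨d, rfl⟩ := Nat.exists_eq_add_of_le hmn
    obtain ⟨m, rfl⟩ := Nat.exists_eq_add_of_le' hm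
    rw [show m + 1 + d + 1 = (m + 1) + (d + 1) by ring, Finset.sum_range_add,
      Finset.sum_eq_zero fun k hk => if_neg (by simpa using hk), zero_add]
    refine Eq.trans ?_ ((congrArg ((-1 : ℝ) ^ (m + 1) * ·)
      (sum_tauBinom_mul_tauBinom hτ m d)).trans (mul_one _))
    simp only [Finset.mul_sum]
    refine Finset.sum_congr rfl fun j _ => ?_
    rw [if_pos (by omega), Nat.add_sub_cancel_left, Nat.add_sub_cancel,
      show m + 1 + j - 1 = m + j by omega, pow_add]
    ring
  · exact Finset.sum_eq_zero fun k hk => if_neg (by have := Finset.mem_range.1 hk; omega)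

/-! ### Moments of the integrand -/

section Linearity

variable {k : ℕ} {R : ℝ} {f g : (Fin k → ℂ) → ℂ}

theorem contourIntegral_congr (hR : 0 ≤ R) (h : ∀ ξ, (∀ i, ‖ξ i‖ = R) → f ξ = g ξ) :
    contourIntegral R f = contourIntegral R g := by
  unfold contourIntegral
  rw [torusIntegral_congr hR h]

theorem contourIntegral_const_mul (c : ℂ) :
    contourIntegral R (fun ξ => c * f ξ) = c * contourIntegral R f := by
  unfold contourIntegral
  rw [torusIntegral_const_mul]
  ring

theorem contourIntegral_add (hf : TorusIntegrable f 0 fun _ => R)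
    (hg : TorusIntegrable g 0 fun _ => R) :
    contourIntegral R (fun ξ => f ξ + g ξ) = contourIntegral R f + contourIntegral R g := by
  unfold contourIntegral
  rw [torusIntegral_add hf hg, mul_add]

theorem contourIntegral_sub (hf : TorusIntegrable f 0 fun _ => R)
    (hg : TorusIntegrable g 0 fun _ => R) :
    contourIntegral R (fun ξ => f ξ - g ξ) = contourIntegral R f - contourIntegral R g := by
  unfold contourIntegral
  rw [torusIntegral_sub hf hg, mul_sub]

theorem contourIntegral_finsetSum {ι : Type*} (s : Finset ι) {F : ι → (Fin k → ℂ) → ℂ}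
    (hF : ∀ i ∈ s, TorusIntegrable (F i) 0 fun _ => R) :
    contourIntegral R (fun ξ => ∑ i ∈ s, F i ξ) = ∑ i ∈ s, contourIntegral R (F i) := by
  unfold contourIntegral torusIntegral
  simp only [Finset.smul_sum]
  rw [integral_finsetSum _ fun i hi => (hF i hi).function_integrable, Finset.mul_sum]

end Linearity

section Moments

variable {p q R : ℝ} {k : ℕ}

/-- The coefficient of `t ^ n / n!` in the integrand. -/
noncomputable def momentFun (p q : ℝ) (x : ℤ) (n : ℕ) (y : Fin k → ℤ) (ξ : Fin k → ℂ) : ℂ :=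
  kernelFun p q (fun i => x - y i - 1) ξ * (1 - ∏ i, ξ i) * (∑ i, eps p q (ξ i)) ^ n

/-- The contour integral of `momentFun`. -/
noncomputable def moment (p q R : ℝ) (x : ℤ) (n : ℕ) (y : Fin k → ℤ) : ℂ :=
  contourIntegral R (momentFun p q x n y)

theorem integrand_eq (p q : ℝ) (y : Fin k → ℤ) (x : ℤ) (t : ℝ) (ξ : Fin k → ℂ) :
    integrand p q y x t ξ = kernelFun p q (fun i => x - y i - 1) ξ * (1 - ∏ i, ξ i) *
      Complex.exp ((∑ i, eps p q (ξ i)) * t) := by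
  unfold integrand kernelFun coupling
  rw [Finset.prod_mul_distrib, Finset.prod_inv_distrib]
  ring

theorem continuousOn_sum_eps (hR : IsLargeRadius p q R) :
    ContinuousOn (fun ξ : Fin k → ℂ => ∑ i, eps p q (ξ i)) {ξ | ∀ i, ‖ξ i‖ = R} := by
  unfold eps
  refine continuousOn_finsetSum _ fun i _ => ?_
  have h : ContinuousOn (fun ξ : Fin k → ℂ => (ξ i)⁻¹) {ξ | ∀ i, ‖ξ i‖ = R} :=
    ContinuousOn.inv₀ (by fun_prop) fun ξ hξ => hR.ne_zero (hξ i).ge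
  fun_prop

theorem continuousOn_momentFun (hR : IsLargeRadius p q R) (x : ℤ) (n : ℕ) (y : Fin k → ℤ) :
    ContinuousOn (momentFun p q x n y) {ξ | ∀ i, ‖ξ i‖ = R} := by
  unfold momentFun
  exact ((continuousOn_kernelFun hR _).mul (by fun_prop)).mul ((continuousOn_sum_eps hR).pow n)

theorem torusIntegrable_momentFun (hR : IsLargeRadius p q R) (x : ℤ) (n : ℕ) (y : Fin k → ℤ) :
    TorusIntegrable (momentFun p q x n y) 0 fun _ => R :=
  torusIntegrable_of_continuousOn hR.pos.le (continuousOn_momentFun hR x n y)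

theorem momentFun_update (p q : ℝ) (x : ℤ) (n : ℕ) (y : Fin k → ℤ) (a : Fin k) (d : ℤ)
    {ξ : Fin k → ℂ} (ha : ξ a ≠ 0) :
    momentFun p q x n (Function.update y a (y a + d)) ξ = ξ a ^ (-d) * momentFun p q x n y ξ := by
  unfold momentFun kernelFun
  rw [← Finset.mul_prod_erase _ (fun i => (1 - ξ i)⁻¹ * ξ i ^ (x - y i - 1)) (Finset.mem_univ a),
    ← Finset.mul_prod_erase _
      (fun i => (1 - ξ i)⁻¹ * ξ i ^ (x - Function.update y a (y a + d) i - 1)) (Finset.mem_univ a),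
    Function.update_self, show x - (y a + d) - 1 = -d + (x - y a - 1) by ring, zpow_add₀ ha]
  have h : ∏ i ∈ Finset.univ.erase a,
      (1 - ξ i)⁻¹ * ξ i ^ (x - Function.update y a (y a + d) i - 1) =
      ∏ i ∈ Finset.univ.erase a, (1 - ξ i)⁻¹ * ξ i ^ (x - y i - 1) :=
    Finset.prod_congr rfl fun i hi => by rw [Function.update_of_ne (Finset.ne_of_mem_erase hi)]
  rw [h]
  ring

/-- Multiplication by `∏ ξ i` raises every exponent by one, which replaces `x - 1` by `x`. -/
theorem moment_zero (hR : IsLargeRadius p q R) (x : ℤ) (y : Fin k → ℤ) :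
    moment p q R x 0 y = kernelIntegral p q R (fun i => x - 1 - y i) -
      kernelIntegral p q R (fun i => x - y i) := by
  unfold moment kernelIntegral
  rw [← contourIntegral_sub (torusIntegrable_kernelFun hR _) (torusIntegrable_kernelFun hR _)]
  refine contourIntegral_congr hR.pos.le fun ξ hξ => ?_
  have h : ∀ i, ξ i ^ (x - y i) = ξ i ^ (x - y i - 1) * ξ i := fun i => by
    rw [← zpow_add_one₀ (hR.ne_zero (hξ i).ge), sub_add_cancel]
  unfold momentFun kernelFun
  simp only [h, sub_right_comm x 1, Finset.prod_mul_distrib]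
  ring

theorem continuousOn_momentFun_comb (hR : IsLargeRadius p q R) (x : ℤ) (n : ℕ)
    (y₁ y₂ y₃ : Fin k → ℤ) :
    ContinuousOn (fun ξ => p * momentFun p q x n y₁ ξ + q * momentFun p q x n y₂ ξ -
      momentFun p q x n y₃ ξ) {ξ | ∀ i, ‖ξ i‖ = R} :=
  ((continuousOn_const.mul (continuousOn_momentFun hR x n y₁)).add
    (continuousOn_const.mul (continuousOn_momentFun hR x n y₂))).sub (continuousOn_momentFun hR x n y₃)

theorem moment_comb (hR : IsLargeRadius p q R) (x : ℤ) (n : ℕ) (y₁ y₂ y₃ : Fin k → ℤ) :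
    p * moment p q R x n y₁ + q * moment p q R x n y₂ - moment p q R x n y₃ =
      contourIntegral R (fun ξ => p * momentFun p q x n y₁ ξ + q * momentFun p q x n y₂ ξ -
        momentFun p q x n y₃ ξ) := by
  have hc : ∀ (c : ℂ) (y : Fin k → ℤ), TorusIntegrable (fun ξ => c * momentFun p q x n y ξ) 0
      fun _ => R := fun c y => torusIntegrable_of_continuousOn hR.pos.le
    (continuousOn_const.mul (continuousOn_momentFun hR x n y))
  have hadd : TorusIntegrable
      (fun ξ => p * momentFun p q x n y₁ ξ + q * momentFun p q x n y₂ ξ) 0 fun _ => R :=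
    (hc _ _).add (hc _ _)
  rw [contourIntegral_sub hadd (torusIntegrable_momentFun hR x n y₃),
    contourIntegral_add (hc _ _) (hc _ _), contourIntegral_const_mul, contourIntegral_const_mul]
  rfl

/-- Shifting `y a` by `±1` multiplies the integrand by `ξ a ^ (∓1)`, so one factor `∑ ε(ξ a)` acts
as the generator of free walks. -/
theorem moment_succ (hR : IsLargeRadius p q R) (x : ℤ) (n : ℕ) (y : Fin k → ℤ) :
    moment p q R x (n + 1) y =
      ∑ a, (p * moment p q R x n (Function.update y a (y a + 1)) +
        q * moment p q R x n (Function.update y a (y a - 1)) - moment p q R x n y) := by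
  simp only [moment_comb hR]
  rw [← contourIntegral_finsetSum _ fun a _ => torusIntegrable_of_continuousOn hR.pos.le
    (continuousOn_momentFun_comb hR x n _ _ _)]
  refine contourIntegral_congr hR.pos.le fun ξ hξ => ?_
  have h : ∀ a, p * momentFun p q x n (Function.update y a (y a + 1)) ξ +
        q * momentFun p q x n (Function.update y a (y a - 1)) ξ - momentFun p q x n y ξ =
      momentFun p q x n y ξ * eps p q (ξ a) := by
    intro a
    have ha := hR.ne_zero (hξ a).ge
    rw [momentFun_update p q x n y a 1 ha, sub_eq_add_neg (y a), momentFun_update p q x n y a _ ha,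
      neg_neg, zpow_one, zpow_neg_one, eps]
    ring
  simp only [h]
  rw [← Finset.mul_sum]
  unfold momentFun
  ring

/-- The prefactor turns the coupling of the pair into the antisymmetric `ξ b - ξ a`; the product of
all other factors is symmetric. -/
theorem fpq_mul_momentFun_swap (hR : IsLargeRadius p q R) (x : ℤ) (n : ℕ) {y : Fin k → ℤ}
    {a b : Fin k} (hab : (a : ℕ) + 1 = b) (hy : y a = y b) {ξ : Fin k → ℂ}
    (hξ : ∀ i, ‖ξ i‖ = R) :
    fpq p q (ξ (Equiv.swap a b a)) (ξ (Equiv.swap a b b)) *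
        momentFun p q x n y (fun i => ξ (Equiv.swap a b i)) =
      -(fpq p q (ξ a) (ξ b) * momentFun p q x n y ξ) := by
  have hys : ∀ i, y (Equiv.swap a b i) = y i := by
    intro i
    rw [Equiv.swap_apply_def]
    split_ifs with h1 h2
    · rw [h1, hy]
    · rw [h2, hy]
    · rfl
  obtain ⟨Q, hQ1, hQ2⟩ := prod_pairs_swap (fun i j => coupling p q (ξ i) (ξ j)) hab
  have hprod : ∏ i, ((1 - ξ (Equiv.swap a b i))⁻¹ * ξ (Equiv.swap a b i) ^ (x - y i - 1)) =
      ∏ i, ((1 - ξ i)⁻¹ * ξ i ^ (x - y i - 1)) := by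
    rw [← Equiv.prod_comp (Equiv.swap a b) fun i => (1 - ξ i)⁻¹ * ξ i ^ (x - y i - 1)]
    simp only [hys]
  unfold momentFun kernelFun
  rw [hQ1, hQ2, hprod, Equiv.prod_comp (Equiv.swap a b) ξ,
    Equiv.sum_comp (Equiv.swap a b) fun i => eps p q (ξ i), Equiv.swap_apply_left,
    Equiv.swap_apply_right]
  have h1 : fpq p q (ξ b) (ξ a) * coupling p q (ξ b) (ξ a) = ξ a - ξ b :=
    mul_div_cancel₀ _ (hR.2 _ _ (hξ b).ge (hξ a).ge)
  have h2 : fpq p q (ξ a) (ξ b) * coupling p q (ξ a) (ξ b) = ξ b - ξ a :=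
    mul_div_cancel₀ _ (hR.2 _ _ (hξ a).ge (hξ b).ge)
  set W := Q * (∏ i, ((1 - ξ i)⁻¹ * ξ i ^ (x - y i - 1))) * (1 - ∏ i, ξ i) *
    (∑ i, eps p q (ξ i)) ^ n with hW
  linear_combination W * h1 + W * h2

/-- With `y a` moved onto `y b`, the three terms combine to the factor `f(ξ a, ξ b)`, and the
integrand becomes antisymmetric. -/
theorem moment_boundary (hR : IsLargeRadius p q R) (x : ℤ) (n : ℕ) {y : Fin k → ℤ}
    {a b : Fin k} (hab : (a : ℕ) + 1 = b) (hy : y b = y a + 1) :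
    p * moment p q R x n (Function.update y a (y a + 1)) +
      q * moment p q R x n (Function.update y b (y b - 1)) - moment p q R x n y = 0 := by
  rw [moment_comb hR]
  set y' := Function.update y a (y a + 1) with hy'
  have hne : b ≠ a := by rw [Ne, Fin.ext_iff]; omega
  have hyab : y' a = y' b := by rw [hy', Function.update_self, Function.update_of_ne hne, hy]
  rw [contourIntegral_congr (g := fun ξ => fpq p q (ξ a) (ξ b) * momentFun p q x n y' ξ) hR.pos.le]
  · unfold contourIntegral
    rw [torusIntegral_eq_zero_of_antisymm hR.pos.le (Equiv.swap a b), mul_zero]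
    intro ξ hξ
    exact fpq_mul_momentFun_swap hR x n hab hyab hξ
  · intro ξ hξ
    have ha := hR.ne_zero (hξ a).ge
    rw [hy', momentFun_update p q x n y a 1 ha, sub_eq_add_neg (y b),
      momentFun_update p q x n y b _ (hR.ne_zero (hξ b).ge), neg_neg, zpow_one, zpow_neg_one, fpq]
    field_simp

end Moments

/-! ### The sum over subsets solves the backward equation -/

section Evolution

variable {N : ℕ} {p q R : ℝ}

/-- The coefficient attached to a subset of the particles. -/
noncomputable def weight (p q : ℝ) (m : ℕ) (S : Finset (Fin N)) : ℝ :=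
  (p / q) ^ (((m * (m - 1) / 2 : ℕ) : ℤ) + (sig S : ℤ) - (m : ℤ) * (S.card : ℤ)) *
    q ^ (S.card * (S.card - 1) / 2) * tauBinom (p / q) (S.card - 1) (m - 1)

/-- The moment attached to the particles in a subset. -/
noncomputable def subsetMoment (p q R : ℝ) (x : ℤ) (n : ℕ) (S : Finset (Fin N)) (y : Fin N → ℤ) :
    ℂ :=
  moment p q R x n (fun i => y (S.orderEmbOfFin rfl i))

/-- The weighted sum of moments over all subsets with at least `m` elements. -/
noncomputable def weightedMoment (p q R : ℝ) (m : ℕ) (x : ℤ) (n : ℕ) (y : Fin N → ℤ) : ℂ :=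
  ∑ S : Finset (Fin N) with m ≤ S.card, (weight p q m S : ℂ) * subsetMoment p q R x n S y

theorem subsetMoment_eq (x : ℤ) (n : ℕ) {S : Finset (Fin N)} {k : ℕ} (h : S.card = k)
    (y : Fin N → ℤ) :
    subsetMoment p q R x n S y = moment p q R x n (fun i => y (S.orderEmbOfFin h i)) := by
  subst h
  rfl

theorem subsetMoment_congr (x : ℤ) (n : ℕ) {S : Finset (Fin N)} {y y' : Fin N → ℤ}
    (h : ∀ i ∈ S, y i = y' i) : subsetMoment p q R x n S y = subsetMoment p q R x n S y' := by
  unfold subsetMoment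
  congr 1
  ext i
  exact h _ (S.orderEmbOfFin_mem rfl i)

theorem subsetMoment_update_of_notMem (x : ℤ) (n : ℕ) {S : Finset (Fin N)} (y : Fin N → ℤ)
    {i : Fin N} (hi : i ∉ S) (v : ℤ) :
    subsetMoment p q R x n S (Function.update y i v) = subsetMoment p q R x n S y :=
  subsetMoment_congr x n fun j hj => Function.update_of_ne (fun h : j = i => hi (h ▸ hj)) _ _

theorem subsetMoment_update (x : ℤ) (n : ℕ) (S : Finset (Fin N)) (y : Fin N → ℤ)
    (a : Fin S.card) (v : ℤ) :
    subsetMoment p q R x n S (Function.update y (S.orderEmbOfFin rfl a) v) =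
      moment p q R x n (Function.update (fun i => y (S.orderEmbOfFin rfl i)) a v) := by
  unfold subsetMoment
  congr 1
  exact Function.update_comp_eq_of_injective y (S.orderEmbOfFin rfl).injective a v

theorem exists_orderEmbOfFin_eq {S : Finset (Fin N)} {i : Fin N} (hi : i ∈ S) :
    ∃ a, S.orderEmbOfFin rfl a = i := by
  have : i ∈ Set.range (S.orderEmbOfFin rfl) := by rw [Finset.range_orderEmbOfFin]; exact hi
  exact this

/-- Particles outside `S` contribute `p + q - 1 = 0`, so that the recursion has the same form for
every subset. -/
theorem subsetMoment_succ (hpq : p + q = 1) (hR : IsLargeRadius p q R) (x : ℤ) (n : ℕ)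
    (S : Finset (Fin N)) (y : Fin N → ℤ) :
    subsetMoment p q R x (n + 1) S y =
      ∑ i, (p * subsetMoment p q R x n S (Function.update y i (y i + 1)) +
        q * subsetMoment p q R x n S (Function.update y i (y i - 1)) -
        subsetMoment p q R x n S y) := by
  have hpqC : (p : ℂ) + q = 1 := by exact_mod_cast hpq
  rw [← Finset.sum_subset (Finset.subset_univ S)]
  · conv_rhs => rw [← S.map_orderEmbOfFin_univ rfl, Finset.sum_map]
    rw [Finset.map_orderEmbOfFin_univ]
    simp only [RelEmbedding.coe_toEmbedding, subsetMoment_update]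
    exact moment_succ hR x n _
  · intro i _ hi
    rw [subsetMoment_update_of_notMem x n y hi, subsetMoment_update_of_notMem x n y hi]
    linear_combination subsetMoment p q R x n S y * hpqC

theorem weightedMoment_succ (hpq : p + q = 1) (hR : IsLargeRadius p q R) (m : ℕ) (x : ℤ) (n : ℕ)
    (y : Fin N → ℤ) :
    weightedMoment p q R m x (n + 1) y =
      ∑ i, (p * weightedMoment p q R m x n (Function.update y i (y i + 1)) +
        q * weightedMoment p q R m x n (Function.update y i (y i - 1)) -
        weightedMoment p q R m x n y) := by
  unfold weightedMoment
  simp only [subsetMoment_succ hpq hR, Finset.mul_sum, ← Finset.sum_add_distrib,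
    ← Finset.sum_sub_distrib]
  rw [Finset.sum_comm]
  refine Finset.sum_congr rfl fun i _ => Finset.sum_congr rfl fun S _ => ?_
  ring

theorem weight_map_swap {m : ℕ} (hq : q ≠ 0) {S : Finset (Fin N)} (hS : m ≤ S.card) {i j : Fin N}
    (hij : (i : ℕ) + 1 = j) (hi : i ∈ S) (hj : j ∉ S) :
    q * weight p q m (S.map (Equiv.swap i j).toEmbedding) = p * weight p q m S := by
  have hsig : sig (S.map (Equiv.swap i j).toEmbedding) = sig S + 1 := by
    rw [sig_eq_sum, sig_eq_sum, Finset.sum_map, ← Finset.add_sum_erase _ _ hi,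
      ← Finset.add_sum_erase _ (fun a : Fin N => (a : ℕ) + 1) hi]
    have : ∀ a ∈ S.erase i, ((Equiv.swap i j).toEmbedding a : ℕ) + 1 = (a : ℕ) + 1 := by
      intro a ha
      rw [Equiv.toEmbedding_apply, Equiv.swap_apply_of_ne_of_ne (Finset.ne_of_mem_erase ha)]
      exact fun h => hj (h ▸ Finset.mem_of_mem_erase ha)
    rw [Finset.sum_congr rfl this, Equiv.toEmbedding_apply, Equiv.swap_apply_left]
    omega
  have hexp := weight_exponent_eq S hS
  unfold weight
  rw [Finset.card_map, hsig]
  have hexp' : ((m * (m - 1) / 2 : ℕ) : ℤ) + ((sig S + 1 : ℕ) : ℤ) - (m : ℤ) * (S.card : ℤ) =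
      ((((S.card - m) * (S.card - m + 1) / 2 + (sig S - S.card * (S.card + 1) / 2)) + 1 : ℕ) : ℤ) := by
    push_cast at hexp ⊢
    linarith
  -- Splitting off one factor `τ` is legitimate at `τ = 0` because both exponents are natural
  -- numbers.
  rw [hexp', hexp, zpow_natCast, zpow_natCast, pow_succ]
  field_simp

theorem swap_lt_swap {i j u v : Fin N} (hij : (i : ℕ) + 1 = j) (huv : u < v)
    (hne : ¬ (u = i ∧ v = j)) : Equiv.swap i j u < Equiv.swap i j v := by
  simp only [Equiv.swap_apply_def]
  simp only [Fin.ext_iff, Fin.lt_def] at *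
  split_ifs <;> omega

/-- The exchange preserves the order within `S`, so the integration variables correspond. -/
theorem subsetMoment_map_swap (x : ℤ) (n : ℕ) {S : Finset (Fin N)} {i j : Fin N}
    (hij : (i : ℕ) + 1 = j) (hS : ¬ (i ∈ S ∧ j ∈ S)) (y : Fin N → ℤ) :
    subsetMoment p q R x n (S.map (Equiv.swap i j).toEmbedding) y =
      subsetMoment p q R x n S (fun a => y (Equiv.swap i j a)) := by
  rw [subsetMoment_eq x n (S.card_map _) y]
  unfold subsetMoment
  congr 1
  have hmono : StrictMono fun a => Equiv.swap i j (S.orderEmbOfFin rfl a) := by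
    intro a b hab
    exact swap_lt_swap hij ((S.orderEmbOfFin rfl).strictMono hab) fun h =>
      hS ⟨h.1 ▸ S.orderEmbOfFin_mem rfl a, h.2 ▸ S.orderEmbOfFin_mem rfl b⟩
  have := Finset.orderEmbOfFin_unique (s := S.map (Equiv.swap i j).toEmbedding) (S.card_map _)
    (fun a => Finset.mem_map_of_mem _ (S.orderEmbOfFin_mem rfl a)) hmono
  ext a
  exact congrArg y (congrFun this a).symm

theorem subsetMoment_boundary (hR : IsLargeRadius p q R) (x : ℤ) (n : ℕ) {S : Finset (Fin N)}
    {y : Fin N → ℤ} {i j : Fin N} (hij : (i : ℕ) + 1 = j) (hy : y j = y i + 1) (hi : i ∈ S)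
    (hj : j ∈ S) :
    p * subsetMoment p q R x n S (Function.update y i (y i + 1)) +
      q * subsetMoment p q R x n S (Function.update y j (y j - 1)) -
      subsetMoment p q R x n S y = 0 := by
  obtain ⟨a, rfl⟩ := exists_orderEmbOfFin_eq hi
  obtain ⟨b, rfl⟩ := exists_orderEmbOfFin_eq hj
  rw [subsetMoment_update, subsetMoment_update]
  refine moment_boundary hR x n (y := fun i => y (S.orderEmbOfFin rfl i)) ?_ hy
  -- No label lies between `i` and `j`, so their ranks in `S` are consecutive too.
  have hab : a < b := (S.orderEmbOfFin rfl).lt_iff_lt.1 (by rw [Fin.lt_def]; omega)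
  by_contra hne
  have hlt : (a : ℕ) + 1 < b := by rw [Fin.lt_def] at hab; omega
  have h1 : S.orderEmbOfFin rfl a < S.orderEmbOfFin rfl ⟨a + 1, by omega⟩ :=
    (S.orderEmbOfFin rfl).strictMono (Fin.lt_def.2 (Nat.lt_succ_self _))
  have h2 : S.orderEmbOfFin rfl ⟨a + 1, by omega⟩ < S.orderEmbOfFin rfl b :=
    (S.orderEmbOfFin rfl).strictMono (Fin.lt_def.2 hlt)
  rw [Fin.lt_def] at h1 h2
  omega

/-- Let `M`, `M'` be the moments of `S` with its particle at `y i` and at `y j`, and `S'` the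
exchanged subset. The two terms are `p w(S) (M' - M)` and `q w(S') (M - M')`, and `q w(S') = p
w(S)`. -/
theorem weightedMoment_boundary_pair (hq : q ≠ 0) (hpq : p + q = 1) {m : ℕ} (x : ℤ) (n : ℕ)
    {S : Finset (Fin N)} (hS : m ≤ S.card) {y : Fin N → ℤ} {i j : Fin N}
    (hij : (i : ℕ) + 1 = j) (hy : y j = y i + 1) (hi : i ∈ S) (hj : j ∉ S) :
    let B := fun S : Finset (Fin N) => (weight p q m S : ℂ) *
      (p * subsetMoment p q R x n S (Function.update y i (y i + 1)) +
        q * subsetMoment p q R x n S (Function.update y j (y j - 1)) - subsetMoment p q R x n S y)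
    B S + B (S.map (Equiv.swap i j).toEmbedding) = 0 := by
  intro B
  have hne : i ≠ j := by rw [Ne, Fin.ext_iff]; omega
  have hnot : ¬ (i ∈ S ∧ j ∈ S) := fun h => hj h.2
  have hw : (q : ℂ) * weight p q m (S.map (Equiv.swap i j).toEmbedding) = p * weight p q m S := by
    exact_mod_cast weight_map_swap hq hS hij hi hj
  have hpqC : (p : ℂ) + q = 1 := by exact_mod_cast hpq
  have hmem : ∀ a ∈ S, a = i ∨ a ≠ i ∧ a ≠ j := fun a ha => by
    by_cases h : a = i
    · exact Or.inl h
    · exact Or.inr ⟨h, fun h' => hj (h' ▸ ha)⟩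
  have e1 : subsetMoment p q R x n (S.map (Equiv.swap i j).toEmbedding) y =
      subsetMoment p q R x n S (Function.update y i (y i + 1)) := by
    rw [subsetMoment_map_swap x n hij hnot]
    refine subsetMoment_congr x n fun a ha => ?_
    rcases hmem a ha with rfl | ⟨h1, h2⟩
    · rw [Equiv.swap_apply_left, Function.update_self, hy]
    · rw [Equiv.swap_apply_of_ne_of_ne h1 h2, Function.update_of_ne h1]
  have hi' : i ∉ S.map (Equiv.swap i j).toEmbedding := by
    rw [Finset.mem_map_equiv, Equiv.symm_swap, Equiv.swap_apply_left]
    exact hj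
  have e2 : subsetMoment p q R x n (S.map (Equiv.swap i j).toEmbedding)
      (Function.update y j (y j - 1)) = subsetMoment p q R x n S y := by
    rw [subsetMoment_map_swap x n hij hnot]
    refine subsetMoment_congr x n fun a ha => ?_
    rcases hmem a ha with rfl | ⟨h1, h2⟩
    · rw [Equiv.swap_apply_left, Function.update_self, hy, add_sub_cancel_right]
    · rw [Equiv.swap_apply_of_ne_of_ne h1 h2, Function.update_of_ne h2]
  simp only [B]
  rw [subsetMoment_update_of_notMem x n y hj, subsetMoment_update_of_notMem x n y hi', e1, e2]
  set M := subsetMoment p q R x n S y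
  set M' := subsetMoment p q R x n S (Function.update y i (y i + 1))
  linear_combination (M - M') * hw +
    (weight p q m S * M + weight p q m (S.map (Equiv.swap i j).toEmbedding) * M') * hpqC

theorem weightedMoment_boundary (hq : q ≠ 0) (hpq : p + q = 1) (hR : IsLargeRadius p q R) (m : ℕ)
    (x : ℤ) (n : ℕ) {y : Fin N → ℤ} {i j : Fin N} (hij : (i : ℕ) + 1 = j) (hy : y j = y i + 1) :
    p * weightedMoment p q R m x n (Function.update y i (y i + 1)) +
      q * weightedMoment p q R m x n (Function.update y j (y j - 1)) -
      weightedMoment p q R m x n y = 0 := by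
  have hpqC : (p : ℂ) + q = 1 := by exact_mod_cast hpq
  set B := fun S : Finset (Fin N) => (weight p q m S : ℂ) *
      (p * subsetMoment p q R x n S (Function.update y i (y i + 1)) +
        q * subsetMoment p q R x n S (Function.update y j (y j - 1)) -
        subsetMoment p q R x n S y) with hB
  have hsum : p * weightedMoment p q R m x n (Function.update y i (y i + 1)) +
      q * weightedMoment p q R m x n (Function.update y j (y j - 1)) -
      weightedMoment p q R m x n y = ∑ S : Finset (Fin N) with m ≤ S.card, B S := by
    unfold weightedMoment
    rw [Finset.mul_sum, Finset.mul_sum, ← Finset.sum_add_distrib, ← Finset.sum_sub_distrib]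
    refine Finset.sum_congr rfl fun S _ => ?_
    simp only [hB]
    ring
  have hinv : ∀ S : Finset (Fin N), (S.map (Equiv.swap i j).toEmbedding).map
      (Equiv.swap i j).toEmbedding = S := by
    intro S
    ext a
    simp [Finset.mem_map_equiv]
  have hmi : ∀ S : Finset (Fin N), i ∈ S.map (Equiv.swap i j).toEmbedding ↔ j ∈ S := by
    intro S
    rw [Finset.mem_map_equiv, Equiv.symm_swap, Equiv.swap_apply_left]
  have hmj : ∀ S : Finset (Fin N), j ∈ S.map (Equiv.swap i j).toEmbedding ↔ i ∈ S := by
    intro S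
    rw [Finset.mem_map_equiv, Equiv.symm_swap, Equiv.swap_apply_right]
  have hboth : ∀ S : Finset (Fin N), i ∈ S → j ∈ S → B S = 0 := by
    intro S hi hj
    simp only [hB]
    rw [subsetMoment_boundary hR x n hij hy hi hj, mul_zero]
  have hneither : ∀ S : Finset (Fin N), i ∉ S → j ∉ S → B S = 0 := by
    intro S hi hj
    simp only [hB]
    rw [subsetMoment_update_of_notMem x n y hi, subsetMoment_update_of_notMem x n y hj]
    linear_combination weight p q m S * subsetMoment p q R x n S y * hpqC
  rw [hsum]
  -- Fixed points contain both or neither of `i`, `j`, and their terms vanish individually.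
  refine Finset.sum_involution (fun S _ => S.map (Equiv.swap i j).toEmbedding) ?_ ?_ ?_ ?_
  · intro S hS
    have hS' : m ≤ S.card := (Finset.mem_filter.1 hS).2
    by_cases hi : i ∈ S <;> by_cases hj : j ∈ S
    · rw [hboth S hi hj, hboth _ ((hmi S).2 hj) ((hmj S).2 hi), add_zero]
    · exact weightedMoment_boundary_pair hq hpq x n hS' hij hy hi hj
    · have := weightedMoment_boundary_pair (R := R) (m := m) hq hpq x n
        (S := S.map (Equiv.swap i j).toEmbedding) (by rwa [Finset.card_map]) hij hy
        ((hmi S).2 hj) (fun h => hi ((hmj S).1 h))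
      simp only [hinv] at this
      rw [add_comm]
      exact this
    · rw [hneither S hi hj, hneither _ (fun h => hj ((hmi S).1 h)) (fun h => hi ((hmj S).1 h)),
        add_zero]
  · intro S _ hS heq
    by_cases hi : i ∈ S <;> by_cases hj : j ∈ S
    · exact hS (hboth S hi hj)
    · exact hj ((hmj S).2 hi |> fun h => heq ▸ h)
    · exact hi ((hmi S).2 hj |> fun h => heq ▸ h)
    · exact hS (hneither S hi hj)
  · intro S hS
    simpa using hS
  · intro S _
    exact hinv S

end Evolution

/-! ### The generator -/

section Generator

variable {N : ℕ}

/-- A blocked jump is a free jump with a correction; at most one particle `j` occupies the target.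
-/
theorem apply_jump (U : (Fin N → ℤ) → ℂ) (η : Config N) (i : Fin N) (d : ℤˣ) :
    U (jump η i d).1 - U η.1 = (U (Function.update η.1 i (η.1 i + d)) - U η.1) -
      ∑ j, if η.1 j = η.1 i + d then U (Function.update η.1 i (η.1 i + d)) - U η.1 else 0 := by
  unfold jump
  split_ifs with h
  · rw [Finset.sum_eq_zero fun j _ => if_neg (h j), sub_zero]
  · push Not at h
    obtain ⟨j, hj⟩ := h
    rw [Finset.sum_eq_single j]
    · rw [if_pos hj, sub_self, sub_self]
    · intro l _ hl
      exact if_neg fun h => hl (η.2.injective (h.trans hj.symm))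
    · simp

/-- For a function that satisfies the boundary conditions, the generator of the interacting system
acts as the generator of independent walks. -/
theorem sum_jump_eq {p q : ℝ} (hpq : p + q = 1) (U : (Fin N → ℤ) → ℂ) (η : Config N)
    (hU : ∀ i j : Fin N, (i : ℕ) + 1 = j → η.1 j = η.1 i + 1 →
      p * U (Function.update η.1 i (η.1 i + 1)) + q * U (Function.update η.1 j (η.1 j - 1)) -
        U η.1 = 0) :
    ∑ i, ((p : ℂ) * (U (jump η i 1).1 - U η.1) + q * (U (jump η i (-1)).1 - U η.1)) =
      ∑ i, (p * U (Function.update η.1 i (η.1 i + 1)) +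
        q * U (Function.update η.1 i (η.1 i - 1)) - U η.1) := by
  have hpqC : (p : ℂ) + q = 1 := by exact_mod_cast hpq
  simp only [apply_jump, Units.val_one, Units.val_neg, ← sub_eq_add_neg]
  have hkey : ∑ i, ((p : ℂ) * ∑ j, (if η.1 j = η.1 i + 1 then
        U (Function.update η.1 i (η.1 i + 1)) - U η.1 else 0) +
      q * ∑ j, (if η.1 j = η.1 i - 1 then
        U (Function.update η.1 i (η.1 i - 1)) - U η.1 else 0)) = 0 := by
    rw [Finset.sum_add_distrib]
    simp only [Finset.mul_sum]
    -- Pairs the blocked right jump of `i` with the blocked left jump of `j`.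
    rw [Finset.sum_comm (f := fun i j => (q : ℂ) * _), ← Finset.sum_add_distrib]
    refine Finset.sum_eq_zero fun i _ => ?_
    rw [← Finset.sum_add_distrib]
    refine Finset.sum_eq_zero fun j _ => ?_
    by_cases h : η.1 j = η.1 i + 1
    · have hij : (i : ℕ) + 1 = j := by
        have hlt : i < j := η.2.lt_iff_lt.1 (by omega)
        by_contra hne
        have hlt' : (i : ℕ) + 1 < j := by rw [Fin.lt_def] at hlt; omega
        have h1 : η.1 i < η.1 ⟨i + 1, by omega⟩ := η.2 (Fin.lt_def.2 (Nat.lt_succ_self _))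
        have h2 : η.1 ⟨i + 1, by omega⟩ < η.1 j := η.2 (Fin.lt_def.2 hlt')
        omega
      rw [if_pos h, if_pos (by omega)]
      linear_combination hU i j hij h - U η.1 * hpqC
    · rw [if_neg h, if_neg (by omega)]
      ring
  refine Eq.trans ?_ ((congrArg (_ - ·) hkey).trans (sub_zero _))
  rw [← Finset.sum_sub_distrib]
  refine Finset.sum_congr rfl fun i _ => ?_
  linear_combination -U η.1 * hpqC

end Generator

/-! ### The initial condition -/

section Initial

variable {N : ℕ} {p q R : ℝ}

theorem kernelIntegral_subset (hp : 0 ≤ p) (hq : 0 < q) (hpq : p + q = 1)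
    (hR : IsLargeRadius p q R) (η : Config N) (S : Finset (Fin N)) (c : ℤ) :
    kernelIntegral p q R (fun i => c - η.1 (S.orderEmbOfFin rfl i)) =
      if ∀ i ∈ S, η.1 i ≤ c then (-1) ^ S.card * ((q : ℂ) ^ (S.card * (S.card - 1) / 2))⁻¹
      else 0 := by
  split_ifs with h
  · refine kernelIntegral_of_strictAnti hp hq hpq hR (fun a b hab => ?_) fun a => ?_
    · exact sub_lt_sub_left (η.2 ((S.orderEmbOfFin rfl).strictMono hab)) c
    · have := h _ (S.orderEmbOfFin_mem rfl a)
      omega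
  · push Not at h
    obtain ⟨i, hi, hlt⟩ := h
    obtain ⟨a, rfl⟩ := exists_orderEmbOfFin_eq hi
    exact kernelIntegral_eq_zero hp hq hR (j := a) (by omega)

theorem exists_le_iff_lt (η : Config N) (c : ℤ) :
    ∃ n ≤ N, ∀ i : Fin N, η.1 i ≤ c ↔ (i : ℕ) < n := by
  classical
  have hex : ∃ n, ∀ h : n < N, c < η.1 ⟨n, h⟩ := ⟨N, fun h => absurd h (lt_irrefl _)⟩
  refine ⟨Nat.find hex, Nat.find_min' hex fun h => absurd h (lt_irrefl _), fun i => ⟨fun h => ?_,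
    fun h => ?_⟩⟩
  · by_contra hn
    have hle := not_lt.1 hn
    have h1 := Nat.find_spec hex (hle.trans_lt i.2)
    have h2 : η.1 ⟨Nat.find hex, hle.trans_lt i.2⟩ ≤ η.1 i := η.2.monotone (Fin.le_def.2 hle)
    omega
  · have := Nat.find_min hex h
    push Not at this
    exact this.2

/-- Only subsets of `{i : η i ≤ c}` survive. That set is an initial segment, and the powers of `q`
in weight and integral cancel. -/
theorem sum_weight_mul_kernelIntegral (hp : 0 ≤ p) (hq : 0 < q) (hpq : p + q = 1)
    (hR : IsLargeRadius p q R) (η : Config N) {m : ℕ} (hm : 1 ≤ m) (hmN : m - 1 < N) (c : ℤ) :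
    ∑ S : Finset (Fin N) with m ≤ S.card, (weight p q m S : ℂ) *
      kernelIntegral p q R (fun i => c - η.1 (S.orderEmbOfFin rfl i)) =
    if η.1 ⟨m - 1, hmN⟩ ≤ c then (-1) ^ m else 0 := by
  obtain ⟨n, hn, hiff⟩ := exists_le_iff_lt η c
  have hsum := sum_subsets_initial_segment (τ := p / q) (div_nonneg hp hq.le) hn hm
  have hcond : η.1 ⟨m - 1, hmN⟩ ≤ c ↔ m ≤ n := by
    rw [hiff]
    simp only
    omega
  have hcast : (if η.1 ⟨m - 1, hmN⟩ ≤ c then (-1) ^ m else 0 : ℂ) =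
      ((if m ≤ n then (-1) ^ m else 0 : ℝ) : ℂ) := by
    simp only [hcond]
    split_ifs <;> simp
  rw [hcast, ← hsum, Complex.ofReal_sum]
  simp only [kernelIntegral_subset hp hq hpq hR, mul_ite, mul_zero]
  rw [← Finset.sum_filter]
  refine Finset.sum_congr ?_ fun S hS => ?_
  · ext S
    simp only [Finset.mem_filter, Finset.mem_univ, true_and, Finset.mem_powerset, hiff,
      Finset.subset_iff]
    tauto
  · have hqC : (q : ℂ) ^ (S.card * (S.card - 1) / 2) ≠ 0 :=
      pow_ne_zero _ (by exact_mod_cast hq.ne')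
    unfold weight
    simp only [Complex.ofReal_mul, Complex.ofReal_pow, Complex.ofReal_neg, Complex.ofReal_one]
    field_simp

theorem weightedMoment_zero (hp : 0 ≤ p) (hq : 0 < q) (hpq : p + q = 1)
    (hR : IsLargeRadius p q R) (η : Config N) {m : ℕ} (hm : 1 ≤ m) (hmN : m - 1 < N) (x : ℤ) :
    weightedMoment p q R m x 0 η.1 =
      (-1) ^ (m - 1) * if η.1 ⟨m - 1, hmN⟩ = x then 1 else 0 := by
  unfold weightedMoment subsetMoment
  simp only [moment_zero hR, mul_sub, Finset.sum_sub_distrib]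
  rw [sum_weight_mul_kernelIntegral hp hq hpq hR η hm hmN,
    sum_weight_mul_kernelIntegral hp hq hpq hR η hm hmN]
  obtain ⟨m, rfl⟩ := Nat.exists_eq_add_of_le' hm
  simp only [Nat.add_sub_cancel, pow_succ]
  split_ifs <;> first | omega | ring

end Initial

/-! ### Powers of the generator and the semigroup -/

section Semigroup

variable {N : ℕ} {p q R : ℝ}

/-- The indicator of the event that the particle `i` is at the site `x`. -/
def siteIndicator (i : Fin N) (x : ℤ) : Config N →ᵇ ℝ :=
  BoundedContinuousFunction.ofNormedAddCommGroupDiscrete (fun η => if η.1 i = x then 1 else 0) 1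
    fun η => by split_ifs <;> simp

theorem siteIndicator_apply (i : Fin N) (x : ℤ) (η : Config N) :
    siteIndicator i x η = if η.1 i = x then 1 else 0 := rfl

theorem generator_apply (f : Config N →ᵇ ℝ) (η : Config N) :
    generator N p q f η = generatorFun p q f η := rfl

theorem generator_pow_apply (hp : 0 ≤ p) (hq : 0 < q) (hpq : p + q = 1)
    (hR : IsLargeRadius p q R) {m : ℕ} (hm : 1 ≤ m) (hmN : m - 1 < N) (x : ℤ) (n : ℕ)
    (η : Config N) :
    (((generator N p q ^ n) (siteIndicator ⟨m - 1, hmN⟩ x) η : ℝ) : ℂ) =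
      (-1) ^ (m - 1) * weightedMoment p q R m x n η.1 := by
  induction n generalizing η with
  | zero =>
    rw [weightedMoment_zero hp hq hpq hR η hm hmN, ← mul_assoc, ← mul_pow, neg_one_mul, neg_neg,
      one_pow, one_mul, pow_zero, one_apply_eq_self, siteIndicator_apply]
    split_ifs <;> simp
  | succ n ih =>
    rw [pow_succ', mul_apply_eq_comp, generator_apply, weightedMoment_succ hpq hR,
      ← sum_jump_eq hpq (weightedMoment p q R m x n) η fun i j hij hy =>
        weightedMoment_boundary hq.ne' hpq hR m x n hij hy]
    unfold generatorFun
    rw [Complex.ofReal_sum, Finset.mul_sum]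
    refine Finset.sum_congr rfl fun i _ => ?_
    simp only [Complex.ofReal_add, Complex.ofReal_mul, Complex.ofReal_sub]
    rw [ih, ih, ih]
    ring

theorem smul_pow_apply {E : Type*} [NormedAddCommGroup E] [NormedSpace ℝ E] (c : ℝ) (A : E →L[ℝ] E)
    (n : ℕ) (f : E) : ((c • A) ^ n) f = c ^ n • (A ^ n) f := by
  rw [smul_pow]
  rfl

theorem hasSum_semigroup_apply (t : ℝ≥0) (f : Config N →ᵇ ℝ) (η : Config N) :
    HasSum (fun n : ℕ => ((n.factorial : ℝ)⁻¹ * (t : ℝ) ^ n) * (generator N p q ^ n) f η)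
      (semigroup N p q t f η) := by
  have h1 := NormedSpace.exp_series_hasSum_exp' (𝕂 := ℝ) ((t : ℝ) • generator N p q)
  have h2 := h1.mapL (ContinuousLinearMap.apply ℝ _ f)
  have h3 := h2.mapL (BoundedContinuousFunction.evalCLM ℝ η)
  refine h3.congr_fun fun n => ?_
  rw [mul_assoc, ← smul_eq_mul, ← smul_eq_mul]
  exact congrArg (fun g : Config N →ᵇ ℝ => (n.factorial : ℝ)⁻¹ • g η)
    (smul_pow_apply (t : ℝ) (generator N p q) n f).symm

/-- Dominated convergence: on the compact torus the prefactor and `∑ ε(ξ i)` are bounded by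
constants `A` and `B`. -/
theorem hasSum_moment (hR : IsLargeRadius p q R) {k : ℕ} (y : Fin k → ℤ) (x : ℤ) (t : ℝ) :
    HasSum (fun n : ℕ => (((n.factorial : ℂ))⁻¹ * (t : ℂ) ^ n) * moment p q R x n y)
      (contourIntegral R (integrand p q y x t)) := by
  unfold moment contourIntegral
  simp only [mul_left_comm _ ((1 / (2 * (Real.pi : ℂ) * Complex.I)) ^ k)]
  refine HasSum.mul_left _ ?_
  simp only [← torusIntegral_const_mul]
  unfold torusIntegral
  set K := {ξ : Fin k → ℂ | ∀ i, ‖ξ i‖ = R} with hK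
  have hcompact : IsCompact K := by
    have : K = Set.univ.pi fun _ : Fin k => Metric.sphere (0 : ℂ) R := by
      ext ξ
      simp [hK]
    rw [this]
    exact isCompact_univ_pi fun _ => isCompact_sphere _ _
  obtain ⟨A, hA⟩ := hcompact.exists_bound_of_continuousOn (continuousOn_momentFun hR x 0 y)
  obtain ⟨B, hB⟩ := hcompact.exists_bound_of_continuousOn (continuousOn_sum_eps (k := k) hR)
  have hmom : ∀ n ξ, momentFun p q x n y ξ = momentFun p q x 0 y ξ * (∑ i, eps p q (ξ i)) ^ n := by
    intro n ξ
    simp [momentFun]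
  have hmem : ∀ θ, torusMap (0 : Fin k → ℂ) (fun _ => R) θ ∈ K := norm_torusMap hR.pos.le
  have hB0 : 0 ≤ B := (norm_nonneg _).trans (hB _ (hmem 0))
  have hA0 : 0 ≤ A := (norm_nonneg _).trans (hA _ (hmem 0))
  have hsummable : Summable fun n : ℕ => R ^ k * A * ((|t| * B) ^ n / n.factorial) :=
    (Real.summable_pow_div_factorial _).mul_left _
  refine hasSum_integral_of_dominated_convergence
    (fun n _ => R ^ k * A * ((|t| * B) ^ n / n.factorial)) ?_ ?_ ?_ ?_ ?_
  · intro n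
    exact (TorusIntegrable.function_integrable (torusIntegrable_of_continuousOn hR.pos.le
      (continuousOn_const.mul (continuousOn_momentFun hR x n y)))).aestronglyMeasurable
  · intro n
    refine .of_forall fun θ => ?_
    have h1 : ‖(∏ i : Fin k, (R : ℂ) * Complex.exp (θ i * Complex.I) * Complex.I)‖ = R ^ k := by
      simp [norm_prod, Complex.norm_exp_ofReal_mul_I, abs_of_pos hR.pos]
    beta_reduce
    rw [norm_smul, h1, hmom, norm_mul, norm_mul, norm_mul, norm_pow, norm_pow, norm_inv,
      Complex.norm_natCast, Complex.norm_real, Real.norm_eq_abs, mul_assoc (R ^ k)]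
    have hR0 : 0 ≤ R ^ k := pow_nonneg hR.pos.le k
    refine mul_le_mul_of_nonneg_left ?_ hR0
    calc (n.factorial : ℝ)⁻¹ * |t| ^ n * (‖momentFun p q x 0 y (torusMap 0 (fun _ => R) θ)‖ *
          ‖∑ i, eps p q (torusMap 0 (fun _ => R) θ i)‖ ^ n)
        ≤ (n.factorial : ℝ)⁻¹ * |t| ^ n * (A * B ^ n) := by
          gcongr
          · exact hA _ (hmem θ)
          · exact hB _ (hmem θ)
      _ = A * ((|t| * B) ^ n / n.factorial) := by rw [mul_pow]; ring
  · exact .of_forall fun _ => hsummable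
  · exact integrableOn_const measure_Icc_lt_top.ne
  · refine .of_forall fun θ => ?_
    simp only [integrand_eq, smul_eq_mul]
    refine HasSum.mul_left _ ?_
    set ξ := torusMap (0 : Fin k → ℂ) (fun _ => R) θ
    have hexp := NormedSpace.exp_series_hasSum_exp' (𝕂 := ℂ) ((∑ i, eps p q (ξ i)) * (t : ℂ))
    rw [← Complex.exp_eq_exp_ℂ] at hexp
    have := hexp.mul_left (momentFun p q x 0 y ξ)
    have h0 : momentFun p q x 0 y ξ =
        kernelFun p q (fun i => x - y i - 1) ξ * (1 - ∏ i, ξ i) := by simp [momentFun]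
    rw [← h0]
    refine this.congr_fun fun n => ?_
    rw [hmom, smul_eq_mul, mul_pow]
    ring

/-- The expectation of the Markov property at time `0`, where the state is almost surely `Y`. -/
theorem measureReal_eq_semigroup {Y : Config N} {Ω : Type*} [MeasurableSpace Ω] {μ : Measure Ω}
    [IsProbabilityMeasure μ] {X : ℝ≥0 → Ω → Config N} (hX : IsASEP p q Y μ X) (i : Fin N) (x : ℤ)
    (t : ℝ≥0) :
    μ.real {ω | (X t ω).1 i = x} = semigroup N p q t (siteIndicator i x) Y := by
  have hle : (⨆ u : Set.Iic (0 : ℝ≥0), MeasurableSpace.comap (X u) inferInstance) ≤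
      (inferInstance : MeasurableSpace Ω) :=
    iSup_le fun u => (hX.measurable u).comap_le
  have h1 := integral_condExp hle (μ := μ) (f := fun ω => siteIndicator i x (X (0 + t) ω))
  have h2 : ∫ ω, siteIndicator i x (X (0 + t) ω) ∂μ = μ.real {ω | (X t ω).1 i = x} := by
    have hset : MeasurableSet {ω | (X t ω).1 i = x} :=
      ((measurable_pi_apply i).comp (measurable_subtype_coe.comp (hX.measurable t)))
        (measurableSet_singleton x)
    rw [← integral_indicator_one hset, zero_add]
    refine integral_congr_ae (.of_forall fun ω => ?_)
    simp [siteIndicator_apply, Set.indicator_apply]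
  rw [← h2, ← h1, integral_congr_ae (hX.markov 0 t (siteIndicator i x))]
  have h3 : (fun ω => semigroup N p q t (siteIndicator i x) (X 0 ω)) =ᵐ[μ]
      fun _ => semigroup N p q t (siteIndicator i x) Y := by
    filter_upwards [hX.start] with ω hω
    rw [hω]
  rw [integral_congr_ae h3, integral_const]
  simp

end Semigroup

end ASEP

theorem theorem4 {N : ℕ} (p q : ℝ) (hp : 0 ≤ p) (hq : 0 ≤ q) (hpq : p + q = 1) (hq0 : q ≠ 0)
    (Y : ASEP.Config N) {Ω : Type*} [MeasurableSpace Ω] (μ : Measure Ω) [IsProbabilityMeasure μ]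
    (X : ℝ≥0 → Ω → ASEP.Config N) (hX : ASEP.IsASEP p q Y μ X)
    (m : ℕ) (hm : 1 ≤ m) (hmN : m ≤ N) (x : ℤ) (t : ℝ≥0)
    (R : ℝ) (hR : ASEP.IsLargeRadius p q R) :
    ((μ.real {ω | (X t ω).1 ⟨m - 1, by omega⟩ = x} : ℝ) : ℂ) =
      (-1) ^ (m - 1) *
        ∑ S : Finset (Fin N) with m ≤ S.card,
          (((p / q) ^ (((m * (m - 1) / 2 : ℕ) : ℤ) + (ASEP.sig S : ℤ) - (m : ℤ) * (S.card : ℤ)) *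
              q ^ (S.card * (S.card - 1) / 2) *
              ASEP.tauBinom (p / q) (S.card - 1) (m - 1) : ℝ) : ℂ) *
            ASEP.contourIntegral R
              (ASEP.integrand p q (fun i => Y.1 (S.orderEmbOfFin rfl i)) x (t : ℝ)) := by
  have hq' : 0 < q := lt_of_le_of_ne hq hq0.symm
  rw [ASEP.measureReal_eq_semigroup hX]
  -- Both sides are sums of series in powers of `t`, so it suffices to compare the terms.
  have h1 := Complex.ofRealCLM.hasSum (ASEP.hasSum_semigroup_apply (p := p) (q := q) t
    (ASEP.siteIndicator ⟨m - 1, by omega⟩ x) Y)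
  refine h1.unique ?_
  have h2 := (hasSum_sum fun (S : Finset (Fin N)) (_ : S ∈ Finset.univ.filter fun S => m ≤ S.card) =>
    (ASEP.hasSum_moment hR (fun i => Y.1 (S.orderEmbOfFin rfl i)) x t).mul_left
      (ASEP.weight p q m S : ℂ)).mul_left ((-1 : ℂ) ^ (m - 1))
  refine h2.congr_fun ?_
  intro n
  simp only [Complex.ofRealCLM_apply, Complex.ofReal_mul]
  rw [ASEP.generator_pow_apply hp hq' hpq hR hm (by omega) x n Y]
  unfold ASEP.weightedMoment ASEP.subsetMoment
  push_cast
  rw [mul_left_comm]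
  congr 1
  rw [Finset.mul_sum]
  exact Finset.sum_congr rfl fun S _ => by ring
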